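/- Let $G$ be a connected algebraic group over $\mathbb{C}$ acting linearly (by an algebraic representation) on a finite-dimensional complex vector space $V$ with finitely many orbits. Then the dual (contragredient) action of $G$ on $V^*$ also has finitely many orbits, and the number of $G$-orbits in $V^*$ equals the number $N$ of $G$-orbits in $V$. Moreover, if $V=\bigsqcup_{i=1}^N\mathcal{O}_i$ and $V^*=\bigsqcup_{j=1}^N\mathcal{O}'_j$ are the orbit decompositions, then there is a bijection between the two sets of orbits under which $\mathcal{O}_i$ corresponds to $\mathcal{O}'_j$ if and only if $\mathbb{P}(\overline{\mathcal{O}_i})\subset\mathbb{P}(V)$ is projectively dual to $\mathbb{P}(\overline{\mathcal{O}'_j})\subset\mathbb{P}(V^*)$. Here closures are Zariski closures, and $\mathbb{P}(Y)=\{[v] : v\in Y\setminus\{0\}\}$ for $Y\subset V$ or $Y\subset V^*$. A nonempty irreducible closed subvariety $X\subset\mathbb{P}(V)$ is projectively dual to $X'\subset\mathbb{P}(V^*)$ if $X'$ is the Zariski closure of the set of all hyperplanes $H\in\mathbb{P}(V^*)$ that contain the embedded tangent space $\mathbb{P}(T_v\,\mathrm{Cone}(X))$ at some smooth point $[v]\in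 X$, where $\mathrm{Cone}(X)\subset V$ is the affine cone over $X$. By convention, $X=\emptyset$ is projectively dual to $X'=\mathbb{P}(V^*)$ only. -/

import Mathlib

open CategoryTheory MonoidalCategory AlgebraicGeometry
open scoped LinearAlgebra.Projectivization MonObj

namespace PyasetskiiDuality

noncomputable section

/-! ### Algebraic groups over `ℂ` and their linear actions

A complex algebraic group is a group object `G` in schemes over `ℂ`, of finite type. -/

/-- The group `G(ℂ)` of complex points of a group scheme `G` over `ℂ`, with the group
law induced by that of `G` (Mathlib's `Hom.group`). -/
abbrev Points (G : Over (Spec (.of ℂ))) : Type :=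
  𝟙_ (Over (Spec (.of ℂ))) ⟶ G

/-- The value `s(g) ∈ ℂ` of a global regular function `s ∈ Γ(G, ⊤)` at a complex point `g`. -/
def evalPoint {G : Over (Spec (.of ℂ))} (g : Points G) (s : Γ(G.left, ⊤)) : ℂ :=
  (Scheme.ΓSpecIso (.of ℂ)).hom (g.left.appTop s)

/-- A linear action of the complex points of `G` on a vector space `V` is algebraic (comes from a
morphism of algebraic groups `G → GL(V)`) when all its matrix coefficients `g ↦ f (g • v)`
are regular functions on `G`. -/
def IsRational {V : Type*} [AddCommGroup V] [Module ℂ V]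
    (G : Over (Spec (.of ℂ))) [GrpObj G] (ρ : Representation ℂ (Points G) V) : Prop :=
  ∀ (v : V) (f : Module.Dual ℂ V), ∃ s : Γ(G.left, ⊤), ∀ g : Points G, f (ρ g v) = evalPoint g s

/-- The set of orbits of a linear action. -/
def orbits {Γ V : Type*} [Group Γ] [AddCommGroup V] [Module ℂ V]
    (ρ : Representation ℂ Γ V) : Set (Set V) :=
  Set.range fun v : V => Set.range fun g : Γ => ρ g v

section Affine

variable {V : Type*} [AddCommGroup V] [Module ℂ V]

/-! ### Affine algebraic geometry in a vector space -/

variable (V) in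
/-- The algebra of polynomial functions on `V`, generated by the linear forms. -/
def polyFun : Subalgebra ℂ (V → ℂ) :=
  Algebra.adjoin ℂ (Set.range fun f : Module.Dual ℂ V => (f : V → ℂ))

/-- The Zariski closure of a subset of `V`. -/
def zariskiClosure (S : Set V) : Set V :=
  {v | ∀ p ∈ polyFun V, (∀ x ∈ S, p x = 0) → p v = 0}

/-- The coordinate ring `ℂ[Y]` of `Y ⊆ V`: the algebra of restrictions to `Y` of
polynomial functions. -/
def coordRing (Y : Set V) : Subalgebra ℂ (Y → ℂ) :=
  Algebra.adjoin ℂ (Set.range fun (f : Module.Dual ℂ V) (y : Y) => f y)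

/-- Evaluation `ℂ[Y] → ℂ` at a point of `Y`; its kernel is the maximal ideal of the point. -/
def evalAt (Y : Set V) (y : Y) : coordRing Y →ₐ[ℂ] ℂ :=
  (Pi.evalAlgHom ℂ (fun _ : Y => ℂ) y).comp (coordRing Y).val

instance (Y : Set V) (y : Y) : (RingHom.ker (evalAt Y y)).IsPrime :=
  RingHom.ker_isPrime _

/-- `v` is a smooth point of the (closed) subvariety `Y ⊆ V`. -/
def IsSmoothPoint (Y : Set V) (v : V) : Prop :=
  ∃ h : v ∈ Y, Algebra.IsSmoothAt ℂ (RingHom.ker (evalAt Y ⟨v, h⟩))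

/-- The Zariski tangent space `T_v Y ⊆ V`: the directions killed by the differentials at `v` of
all polynomial functions vanishing on `Y`. -/
def tangentSpace (Y : Set V) (v : V) : Set V :=
  {w | ∀ p ∈ polyFun V, (∀ y ∈ Y, p y = 0) → lineDeriv ℂ p v w = 0}

/-! ### Projective geometry -/

/-- `ℙ(Y) ⊆ ℙ(V)`: the points represented by the nonzero vectors of `Y`. -/
def projectivize (Y : Set V) : Set (ℙ ℂ V) :=
  {x | ∃ (v : V) (hv : v ≠ 0), v ∈ Y ∧ Projectivization.mk ℂ v hv = x}

/-- The affine cone over `X ⊆ ℙ(V)`, the union of `{0}` and of all lines belonging to `X`. -/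
def cone (X : Set (ℙ ℂ V)) : Set V :=
  {v | ∀ hv : v ≠ 0, Projectivization.mk ℂ v hv ∈ X}

/-- The Zariski closure of a subset of `ℙ(V)`: the common zeros of all the homogeneous
polynomials that vanish on it. -/
def projClosure (S : Set (ℙ ℂ V)) : Set (ℙ ℂ V) :=
  {x | ∀ p ∈ polyFun V, (∃ d : ℕ, ∀ (c : ℂ) (v : V), p (c • v) = c ^ d * p v) →
    (∀ y ∈ S, p y.rep = 0) → p x.rep = 0}

/-- The hyperplane `H ⊆ ℙ(V)`, a point of `ℙ(V*)`, is tangent to `X ⊆ ℙ(V)`: it contains the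
embedded tangent space `ℙ(T_v (cone X))` at some smooth point `[v]` of `X`. Here `[v]` is a
smooth point of `X` exactly when `v ≠ 0` is a smooth point of the cone. -/
def IsTangentHyperplane (X : Set (ℙ ℂ V)) (H : ℙ ℂ (Module.Dual ℂ V)) : Prop :=
  ∃ v : V, v ≠ 0 ∧ IsSmoothPoint (cone X) v ∧
    ∀ f ∈ H.submodule, ∀ w ∈ tangentSpace (cone X) v, f w = 0

/-- The dual variety `X* ⊆ ℙ(V*)` of a (nonempty, irreducible, closed) `X ⊆ ℙ(V)`: the Zariski
closure of the set of all tangent hyperplanes. -/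
def dualVariety (X : Set (ℙ ℂ V)) : Set (ℙ ℂ (Module.Dual ℂ V)) :=
  projClosure {H | IsTangentHyperplane X H}

/-- `X ⊆ ℙ(V)` is projectively dual to `X' ⊆ ℙ(V*)`. The empty set has no tangent hyperplanes in
the sense above; by convention it is dual to the whole space `ℙ(V*)` (just as the definition
makes `ℙ(V)` dual to the empty set). -/
def IsProjectivelyDual (X : Set (ℙ ℂ V)) (X' : Set (ℙ ℂ (Module.Dual ℂ V))) : Prop :=
  (X = ∅ ∧ X' = Set.univ) ∨ (X.Nonempty ∧ dualVariety X = X')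

end Affine

end

end PyasetskiiDuality

/-!
For an orbit `O ⊆ V` let `N(O) ⊆ V × V*` be its conormal bundle, and for an orbit `O' ⊆ V*` let
`N(O')` be its conormal bundle, with the factors exchanged. All of these are irreducible of
dimension `dim V`, and both the union of the `N(O)` and the union of the `N(O')` equal the zero
fibre of the moment map, because `ξ` annihilates `T_x (G x)` if and only if `x` annihilates
`T_ξ (G ξ)`. When there are finitely many orbits in `V`, every `N(O')` therefore has the same
closure as some `N(O)`, and since an orbit is recovered from the closure of its conormal bundle by
projection, this is a bijection. Finally, the closure of the projection of `N(O)` to `V*` is the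
cone over the variety that is projectively dual to the closure of `ℙ(O)`.
-/

namespace PyasetskiiDuality

noncomputable section

/-! ### Points, tangent vectors and generic smoothness -/

section CommutativeAlgebra

universe u

theorem exists_ne_zero_smooth_away (B A : Type*) [CommRing B] [CommRing A] [IsDomain B]
    [IsDomain A] [CharZero B] [IsNoetherianRing B] [Algebra B A] [Algebra.FiniteType B A]
    (hinj : Function.Injective (algebraMap B A)) :
    ∃ f : A, f ≠ 0 ∧ Algebra.Smooth B (Localization.Away f) := by
  have : Algebra.FinitePresentation B A := Algebra.FinitePresentation.of_finiteType.mp inferInstance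
  have : FaithfulSMul B A := (faithfulSMul_iff_algebraMap_injective B A).mpr hinj
  let K := Localization.AtPrime (⊥ : Ideal A)
  have : IsFractionRing A K := by
    have : (⊥ : Ideal A).primeCompl = nonZeroDivisors A := by
      ext x
      simp [Ideal.primeCompl]
    rw [IsFractionRing, ← this]
    infer_instance
  let : Field K := IsFractionRing.toField A
  let L := FractionRing B
  have : FaithfulSMul B K := FaithfulSMul.trans B A K
  let : Algebra L K := FractionRing.liftAlgebra B K
  have : IsScalarTower B L K := FractionRing.isScalarTower_liftAlgebra B K
  have : CharZero L := charZero_of_injective_algebraMap (IsFractionRing.injective B L)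
  have : Algebra.EssFiniteType A K :=
    Algebra.EssFiniteType.of_isLocalization _ (⊥ : Ideal A).primeCompl
  have : Algebra.EssFiniteType B K := Algebra.EssFiniteType.comp B A K
  have : Algebra.EssFiniteType L K := Algebra.EssFiniteType.of_comp B L K
  have : Algebra.FormallySmooth L K := Algebra.FormallySmooth.of_perfectField
  have : Algebra.FormallySmooth B L := Algebra.FormallySmooth.of_isLocalization (nonZeroDivisors B)
  have : Algebra.IsSmoothAt B (⊥ : Ideal A) := Algebra.FormallySmooth.comp B L K
  obtain ⟨f, hf, h⟩ := Algebra.IsSmoothAt.exists_notMem_smooth B (⊥ : Ideal A)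
  exact ⟨f, hf, h⟩

theorem exists_lift_of_formallySmooth {k B A C D : Type*} [CommRing k] [CommRing B] [CommRing A]
    [CommRing C] [CommRing D] [Algebra k B] [Algebra k A] [Algebra k C] [Algebra k D] [Algebra B A]
    [IsScalarTower k B A] [Algebra.FormallySmooth B A] {π : D →ₐ[k] C}
    (hπ : Function.Surjective π) (hker : IsNilpotent (RingHom.ker (π : D →+* C)))
    {ψ : B →ₐ[k] D} {χ : A →ₐ[k] C} (h : ∀ b, χ (algebraMap B A b) = π (ψ b)) :
    ∃ φ : A →ₐ[k] D, π.comp φ = χ ∧ ∀ b, φ (algebraMap B A b) = ψ b := by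
  let : Algebra B D := ψ.toAlgebra
  let : Algebra B C := (π.comp ψ).toAlgebra
  have : IsScalarTower k B D := .of_algebraMap_eq fun c => (ψ.commutes c).symm
  let πB : D →ₐ[B] C := { π with commutes' := fun _ => rfl }
  let χB : A →ₐ[B] C := { χ with commutes' := h }
  let φ := Algebra.FormallySmooth.liftOfSurjective χB πB hπ hker
  exact ⟨φ.restrictScalars k,
    AlgHom.ext (Algebra.FormallySmooth.liftOfSurjective_apply χB πB hπ hker), φ.commutes⟩

theorem exists_algHom_of_finiteType (k A : Type*) [Field k] [IsAlgClosed k] [CommRing A]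
    [Algebra k A] [Algebra.FiniteType k A] [Nontrivial A] : Nonempty (A →ₐ[k] k) := by
  obtain ⟨m, hm⟩ := Ideal.exists_maximal A
  let : Field (A ⧸ m) := Ideal.Quotient.field m
  have : Module.Finite k (A ⧸ m) := finite_of_finite_type_of_isJacobsonRing k (A ⧸ m)
  exact ⟨(IsAlgClosed.lift : (A ⧸ m) →ₐ[k] k).comp (Ideal.Quotient.mkₐ k m)⟩

theorem exists_algHom_apply_ne_zero {k A : Type*} [Field k] [IsAlgClosed k] [CommRing A]
    [Algebra k A] [Algebra.FiniteType k A] [IsReduced A] {a : A} (ha : a ≠ 0) :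
    ∃ χ : A →ₐ[k] k, χ a ≠ 0 := by
  have : Nontrivial (Localization.Away a) := by
    rw [← not_subsingleton_iff_nontrivial,
      IsLocalization.subsingleton_iff (M := Submonoid.powers a)]
    rintro ⟨n, hn⟩
    exact ha (IsNilpotent.eq_zero ⟨n, hn⟩)
  have : Algebra.FiniteType k (Localization.Away a) :=
    Algebra.FiniteType.trans (S := A) inferInstance inferInstance
  obtain ⟨χ⟩ := exists_algHom_of_finiteType k (Localization.Away a)
  exact ⟨χ.comp (IsScalarTower.toAlgHom k A _),
    ((IsLocalization.Away.algebraMap_isUnit a).map χ).ne_zero⟩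

theorem exists_algHom_extends_of_mem_range_comap {k B A : Type*} [Field k] [IsAlgClosed k]
    [CommRing B] [CommRing A] [Algebra k B] [Algebra k A] [Algebra B A] [IsScalarTower k B A]
    [Algebra.FiniteType k A] (ψ : B →ₐ[k] k)
    (hψ : ⟨RingHom.ker ψ, RingHom.ker_isPrime ψ⟩ ∈
      Set.range (PrimeSpectrum.comap (algebraMap B A))) :
    ∃ χ : A →ₐ[k] k, ∀ b, χ (algebraMap B A b) = ψ b := by
  obtain ⟨P, hP⟩ := hψ
  obtain ⟨χ⟩ := exists_algHom_of_finiteType k (A ⧸ P.asIdeal)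
  refine ⟨χ.comp (Ideal.Quotient.mkₐ k P.asIdeal), fun b => ?_⟩
  have hb : b - algebraMap k B (ψ b) ∈ P.asIdeal.comap (algebraMap B A) := by
    rw [← PrimeSpectrum.comap_asIdeal, hP]
    simp [RingHom.mem_ker]
  rw [Ideal.mem_comap, map_sub, ← IsScalarTower.algebraMap_apply,
    ← Ideal.Quotient.mk_eq_mk_iff_sub_mem] at hb
  simpa using congr(χ $hb)

theorem exists_ne_zero_forall_algHom_extends (k B A : Type*) [Field k] [IsAlgClosed k] [CharZero k]
    [CommRing B] [CommRing A] [IsDomain B] [IsDomain A] [Algebra k B] [Algebra k A] [Algebra B A]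
    [IsScalarTower k B A] [Algebra.FiniteType k B] [Algebra.FiniteType k A]
    (hinj : Function.Injective (algebraMap B A)) :
    ∃ b : B, b ≠ 0 ∧ ∀ ψ : B →ₐ[k] k, ψ b ≠ 0 →
      ∃ χ : A →ₐ[k] k, ∀ x, χ (algebraMap B A x) = ψ x := by
  have : CharZero B := charZero_of_injective_algebraMap (FaithfulSMul.algebraMap_injective k B)
  have : IsNoetherianRing B := Algebra.FiniteType.isNoetherianRing k B
  have : Algebra.FiniteType B A := Algebra.FiniteType.of_restrictScalars_finiteType k B A
  obtain ⟨f, hf, hs⟩ := exists_ne_zero_smooth_away B A hinj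
  let Af := Localization.Away f
  have hAf : Function.Injective (algebraMap A Af) :=
    IsLocalization.injective Af (powers_le_nonZeroDivisors_of_noZeroDivisors hf)
  have : IsDomain Af :=
    IsLocalization.isDomain_localization (powers_le_nonZeroDivisors_of_noZeroDivisors hf)
  have : Algebra.FiniteType k Af := Algebra.FiniteType.trans (S := A) inferInstance inferInstance
  have hopen : IsOpen (Set.range (PrimeSpectrum.comap (algebraMap B Af))) :=
    have : Module.Flat B Af := inferInstance
    (PrimeSpectrum.isOpenMap_comap_of_hasGoingDown_of_finitePresentation
      (R := B) (S := Af)).isOpen_range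
  have hbot : (⊥ : PrimeSpectrum B) ∈ Set.range (PrimeSpectrum.comap (algebraMap B Af)) := by
    refine ⟨⊥, PrimeSpectrum.ext ?_⟩
    rw [PrimeSpectrum.comap_asIdeal, IsScalarTower.algebraMap_eq B A Af]
    exact Ideal.comap_bot_of_injective _ (hAf.comp hinj)
  obtain ⟨_, ⟨_, ⟨b, rfl⟩, rfl⟩, hb, hb'⟩ :=
    PrimeSpectrum.isBasis_basic_opens.exists_subset_of_mem_open hbot hopen
  refine ⟨b, hb, fun ψ hψ => ?_⟩
  obtain ⟨χ, hχ⟩ := exists_algHom_extends_of_mem_range_comap (A := Af) ψ (hb' hψ)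
  exact ⟨χ.comp (IsScalarTower.toAlgHom k A Af), by
    simpa [← IsScalarTower.algebraMap_apply] using hχ⟩

theorem exists_notMem_ker_forall_exists_comp_eq {k S A : Type*} [Field k] [IsAlgClosed k]
    [CharZero k] [CommRing S] [Algebra k S] [Algebra.FiniteType k S] [CommRing A] [IsDomain A]
    [Algebra k A] [Algebra.FiniteType k A] (θ : S →ₐ[k] A) :
    ∃ p ∉ RingHom.ker θ, ∀ ψ : S →ₐ[k] k, RingHom.ker θ ≤ RingHom.ker ψ → ψ p ≠ 0 →
      ∃ χ : A →ₐ[k] k, χ.comp θ = ψ := by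
  have : Algebra.FiniteType k θ.range :=
    Algebra.FiniteType.of_surjective θ.rangeRestrict θ.rangeRestrict_surjective
  obtain ⟨⟨_, p, rfl⟩, hp, H⟩ := exists_ne_zero_forall_algHom_extends k θ.range A
    Subtype.val_injective
  refine ⟨p, fun h => hp (Subtype.ext h), fun ψ hψ hψp => ?_⟩
  have hker : RingHom.ker θ.rangeRestrict ≤ RingHom.ker ψ := by
    rwa [AlgHom.ker_rangeRestrict]
  let ψ' := AlgHom.liftOfSurjective θ.rangeRestrict θ.rangeRestrict_surjective ψ hker
  have hψ' (x : S) : ψ' (θ.rangeRestrict x) = ψ x :=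
    AlgHom.liftOfSurjective_apply _ _ _ _ _
  obtain ⟨χ, hχ⟩ := H ψ' (by rwa [← hψ' p] at hψp)
  exact ⟨χ, AlgHom.ext fun x => (hχ (θ.rangeRestrict x)).trans (hψ' x)⟩

theorem exists_algHom_forall_apply_eq {k A R : Type*} [Field k] [IsAlgClosed k] [CommRing A]
    [IsReduced A] [Algebra k A] [Algebra.FiniteType k A] [CommRing R] [Algebra k R]
    (e : (A →ₐ[k] k) → (R →ₐ[k] k)) (h : ∀ x, ∃ a, ∀ χ, χ a = e χ x) :
    ∃ Φ : R →ₐ[k] A, ∀ χ x, χ (Φ x) = e χ x := by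
  let ev : A →ₐ[k] ((A →ₐ[k] k) → k) := AlgHom.pi fun χ => χ
  have hev : Function.Injective ev := (injective_iff_map_eq_zero ev).mpr fun a ha => by
    by_contra ha'
    obtain ⟨χ, hχ⟩ := exists_algHom_apply_ne_zero (k := k) ha'
    exact hχ (congr_fun ha χ)
  let E : R →ₐ[k] ev.range := (AlgHom.pi e).codRestrict ev.range fun x => by
    obtain ⟨a, ha⟩ := h x
    exact ⟨a, funext ha⟩
  let Φ : R →ₐ[k] A := (AlgEquiv.ofInjective ev hev).symm.toAlgHom.comp E
  refine ⟨Φ, fun χ x => ?_⟩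
  have : ev (Φ x) = E x :=
    congr_arg Subtype.val ((AlgEquiv.ofInjective ev hev).apply_symm_apply (E x))
  exact congr_fun this χ

/-- The `k`-point of `A` with values in the dual numbers that is given by a `k`-point `χ` and a
derivation `d` at `χ`, that is, by a tangent vector of `Spec A` at `χ`. -/
def dualNumberHom {k A : Type*} [CommRing k] [CommRing A] [Algebra k A] (χ : A →ₐ[k] k)
    (d : A →ₗ[k] k) (hd : ∀ a b, d (a * b) = χ a * d b + χ b * d a) : A →ₐ[k] DualNumber k :=
  AlgHom.ofLinearMap
    ((TrivSqZeroExt.inlAlgHom k k k).toLinearMap ∘ₗ χ.toLinearMap + TrivSqZeroExt.inrHom k k ∘ₗ d)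
    (by
      have : d 1 = 0 := by simpa using hd 1 1
      ext <;> simp [this])
    (by
      intro a b
      ext
      · simp
      · simp [hd, mul_comm (d a)])

theorem fst_dualNumberHom {k A : Type*} [CommRing k] [CommRing A] [Algebra k A] (χ : A →ₐ[k] k)
    (d : A →ₗ[k] k) (hd : ∀ a b, d (a * b) = χ a * d b + χ b * d a) (a : A) :
    (dualNumberHom χ d hd a).fst = χ a := by
  simp [dualNumberHom]

theorem snd_dualNumberHom {k A : Type*} [CommRing k] [CommRing A] [Algebra k A] (χ : A →ₐ[k] k)
    (d : A →ₗ[k] k) (hd : ∀ a b, d (a * b) = χ a * d b + χ b * d a) (a : A) :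
    (dualNumberHom χ d hd a).snd = d a := by
  simp [dualNumberHom]

theorem isNilpotent_ker_fstHom (k : Type*) [CommRing k] :
    IsNilpotent (RingHom.ker (TrivSqZeroExt.fstHom k k k : DualNumber k →+* k)) := by
  refine ⟨2, (pow_two (RingHom.ker (TrivSqZeroExt.fstHom k k k : DualNumber k →+* k))).trans ?_⟩
  rw [Ideal.zero_eq_bot, eq_bot_iff, Ideal.mul_le]
  intro a (ha : a.fst = 0) b (hb : b.fst = 0)
  rw [Ideal.mem_bot]
  ext <;> simp [ha, hb]

theorem exists_ne_zero_forall_exists_dualNumber_lift {k B A : Type*} [Field k] [CharZero k]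
    [CommRing B] [CommRing A] [Algebra k B] [Algebra k A] [IsDomain B] [IsDomain A]
    [Algebra.FiniteType k B] [Algebra.FiniteType k A] {g : B →ₐ[k] A}
    (hg : Function.Injective g) :
    ∃ f : A, f ≠ 0 ∧ ∀ (χ : A →ₐ[k] k) (ψ : B →ₐ[k] DualNumber k), χ f ≠ 0 →
      (∀ b, (ψ b).fst = χ (g b)) →
      ∃ φ : A →ₐ[k] DualNumber k, (∀ a, (φ a).fst = χ a) ∧ φ.comp g = ψ := by
  let : Algebra B A := g.toAlgebra
  have : IsScalarTower k B A := .of_algebraMap_eq fun c => (g.commutes c).symm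
  have : CharZero B := charZero_of_injective_algebraMap (algebraMap k B).injective
  have : IsNoetherianRing B := Algebra.FiniteType.isNoetherianRing k B
  have : Algebra.FiniteType B A := Algebra.FiniteType.of_restrictScalars_finiteType k B A
  obtain ⟨f, hf, hs⟩ := exists_ne_zero_smooth_away B A hg
  refine ⟨f, hf, fun χ ψ hχf hψ => ?_⟩
  let Af := Localization.Away f
  have hu (y : Submonoid.powers f) : IsUnit (χ y) := by
    obtain ⟨_, n, rfl⟩ := y
    exact isUnit_iff_ne_zero.mpr (by simpa using fun h => absurd h hχf)
  let χf : Af →ₐ[k] k := IsLocalization.liftAlgHom (M := Submonoid.powers f) hu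
  have χf_algebraMap (a : A) : χf (algebraMap A Af a) = χ a := by simp [χf]
  obtain ⟨φ, hφχ, hφψ⟩ := exists_lift_of_formallySmooth (A := Af) (χ := χf)
    (TrivSqZeroExt.fst_surjective : Function.Surjective (TrivSqZeroExt.fstHom k k k))
    (isNilpotent_ker_fstHom k) fun b => by
      rw [IsScalarTower.algebraMap_apply B A Af, χf_algebraMap]
      exact (hψ b).symm
  refine ⟨φ.comp (IsScalarTower.toAlgHom k A Af), fun a => ?_, AlgHom.ext fun b => ?_⟩
  · exact congr($hφχ (algebraMap A Af a)).trans (χf_algebraMap a)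
  · rw [← hφψ b, IsScalarTower.algebraMap_apply B A Af]
    rfl

theorem exists_notMem_forall_exists_dualNumber_lift {k R S : Type*} [Field k] [CharZero k]
    [CommRing R] [CommRing S] [Algebra k R] [Algebra k S] [Algebra.FiniteType k R]
    [Algebra.FiniteType k S] (g : R →ₐ[k] S) (P : Ideal S) [P.IsPrime] :
    ∃ f ∉ P, ∀ (χ : S →ₐ[k] k) (ψ : R →ₐ[k] DualNumber k), P ≤ RingHom.ker χ → χ f ≠ 0 →
      P.comap g ≤ RingHom.ker ψ → (∀ r, (ψ r).fst = χ (g r)) →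
      ∃ φ : S →ₐ[k] DualNumber k, P ≤ RingHom.ker φ ∧ (∀ s, (φ s).fst = χ s) ∧ φ.comp g = ψ := by
  obtain ⟨f, hf, h⟩ := exists_ne_zero_forall_exists_dualNumber_lift
    (g := Ideal.quotientMapₐ P g le_rfl) Ideal.quotientMap_injective
  obtain ⟨f, rfl⟩ := Ideal.Quotient.mk_surjective f
  refine ⟨f, fun hfP => hf (Ideal.Quotient.eq_zero_iff_mem.mpr hfP), fun χ ψ hχ hχf hψ hψχ => ?_⟩
  obtain ⟨φ, hφχ, hφψ⟩ := h (Ideal.Quotient.liftₐ P χ hχ) (Ideal.Quotient.liftₐ _ ψ hψ) hχf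
    fun b => by
      obtain ⟨r, rfl⟩ := Ideal.Quotient.mk_surjective b
      exact hψχ r
  refine ⟨φ.comp (Ideal.Quotient.mkₐ k P), fun s hs => ?_, fun s => hφχ _, AlgHom.ext fun r =>
    congr($hφψ (Ideal.Quotient.mk _ r))⟩
  rw [RingHom.mem_ker, AlgHom.comp_apply, Ideal.Quotient.mkₐ_eq_mk,
    Ideal.Quotient.eq_zero_iff_mem.mpr hs, map_zero]

section TangentSurjective

variable {k A' A : Type*} [Field k] [CommRing A'] [CommRing A] [Algebra k A'] [Algebra k A]
  {π : A' →ₐ[k] A} {χ : A →ₐ[k] k}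

theorem exists_derivation_of_formallySmooth [Algebra.FormallySmooth k A] (χ : A →ₐ[k] k)
    (hπ : Function.Surjective π) :
    ∃ δ : A' →ₗ[k] A' ⧸ RingHom.ker (χ.comp π) * RingHom.ker π,
      (∀ a, π a = 0 → δ a = Ideal.Quotient.mk _ a) ∧
        ∀ a b, δ (a * b) = χ (π a) • δ b + χ (π b) • δ a := by
  set n := RingHom.ker (χ.comp π)
  set J := n * RingHom.ker π
  let q : (A' ⧸ J) →ₐ[k] A :=
    Ideal.Quotient.liftₐ J π fun _ ha => (Ideal.mul_le_right ha : _ ∈ RingHom.ker π)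
  have mk_mul (a : A') (y : A' ⧸ J) (hy : q y = 0) :
      Ideal.Quotient.mk J a * y = χ (π a) • y := by
    obtain ⟨b, rfl⟩ := Ideal.Quotient.mk_surjective y
    rw [← Ideal.Quotient.mkₐ_eq_mk k, ← map_mul, ← map_smul, Algebra.smul_def,
      Ideal.Quotient.mkₐ_eq_mk, Ideal.Quotient.mk_eq_mk_iff_sub_mem, ← sub_mul]
    exact Ideal.mul_mem_mul (by simp [n, RingHom.mem_ker]) hy
  have mul_eq_zero_of_q (y z : A' ⧸ J) (hy : q y = 0) (hz : q z = 0) : y * z = 0 := by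
    obtain ⟨a, rfl⟩ := Ideal.Quotient.mk_surjective y
    rw [mk_mul a z hz, show π a = 0 from hy, map_zero, zero_smul]
  have hnil : IsNilpotent (RingHom.ker (q : (A' ⧸ J) →+* A)) :=
    ⟨2, by
      rw [pow_two, Ideal.zero_eq_bot, eq_bot_iff, Ideal.mul_le]
      exact fun y hy z hz => mul_eq_zero_of_q y z hy hz⟩
  have hq : Function.Surjective q := Ideal.Quotient.lift_surjective_of_surjective J _ hπ
  let σ : A →ₐ[k] (A' ⧸ J) := Algebra.FormallySmooth.liftOfSurjective (AlgHom.id k A) q hq hnil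
  let δ : A' →ₗ[k] A' ⧸ J := (Ideal.Quotient.mkₐ k J).toLinearMap - (σ.comp π).toLinearMap
  have δ_apply (a : A') : δ a = Ideal.Quotient.mk J a - σ (π a) := rfl
  have q_δ (a : A') : q (δ a) = 0 := by
    have q_σ : q (σ (π a)) = π a :=
      Algebra.FormallySmooth.liftOfSurjective_apply (AlgHom.id k A) q hq hnil (π a)
    rw [δ_apply, map_sub, q_σ]
    exact sub_self (π a)
  refine ⟨δ, fun a ha => by rw [δ_apply, ha, map_zero, sub_zero], fun a b => ?_⟩
  rw [← mk_mul a _ (q_δ b), ← mk_mul b _ (q_δ a)]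
  have := mul_eq_zero_of_q _ _ (q_δ a) (q_δ b)
  simp only [δ_apply, map_mul] at this ⊢
  linear_combination -this

theorem ker_le_mul_ker_of_formallySmooth [Algebra.FormallySmooth k A]
    (hπ : Function.Surjective π)
    (h : ∀ φ : A' →ₐ[k] DualNumber k, (∀ a, (φ a).fst = χ (π a)) → ∀ a, π a = 0 → φ a = 0) :
    RingHom.ker π ≤ RingHom.ker (χ.comp π) * RingHom.ker π := by
  obtain ⟨δ, hδ, hmul⟩ := exists_derivation_of_formallySmooth χ hπ
  intro a ha
  rw [← Ideal.Quotient.eq_zero_iff_mem, ← hδ a ha]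
  refine (Module.forall_dual_apply_eq_zero_iff k _).mp fun l => ?_
  have hd (a b : A') : (l ∘ₗ δ) (a * b) =
      χ.comp π a * (l ∘ₗ δ) b + χ.comp π b * (l ∘ₗ δ) a := by
    simp [hmul]
  rw [← LinearMap.comp_apply, ← snd_dualNumberHom (χ.comp π) (l ∘ₗ δ) hd,
    h _ (fst_dualNumberHom _ _ hd) a ha, TrivSqZeroExt.snd_zero]

theorem injective_of_formallySmooth [Algebra.FormallySmooth k A] [IsLocalRing A']
    [IsNoetherianRing A'] (hπ : Function.Surjective π)
    (h : ∀ φ : A' →ₐ[k] DualNumber k, (∀ a, (φ a).fst = χ (π a)) → ∀ a, π a = 0 → φ a = 0) :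
    Function.Injective π := by
  rw [injective_iff_map_eq_zero']
  have hn : RingHom.ker (χ.comp π) ≤ Ideal.jacobson ⊥ := by
    rw [IsLocalRing.jacobson_eq_maximalIdeal _ bot_ne_top]
    exact IsLocalRing.le_maximalIdeal (RingHom.ker_ne_top _)
  have := Submodule.eq_bot_of_le_smul_of_le_jacobson_bot _ _ (IsNoetherian.noetherian _)
    (ker_le_mul_ker_of_formallySmooth hπ h) hn
  exact fun a => by rw [← RingHom.mem_ker, this, Ideal.mem_bot]

theorem injective_of_isSmoothAt {k : Type*} {R' R : Type u} [Field k] [CommRing R'] [CommRing R]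
    [Algebra k R'] [Algebra k R] [IsDomain R'] [IsNoetherianRing R'] {π : R' →ₐ[k] R}
    (hπ : Function.Surjective π) {χ : R →ₐ[k] k} [(RingHom.ker χ).IsPrime]
    (hs : Algebra.IsSmoothAt k (RingHom.ker χ))
    (h : ∀ φ : R' →ₐ[k] DualNumber k, (∀ r, (φ r).fst = χ (π r)) → ∀ r, π r = 0 → φ r = 0) :
    Function.Injective π := by
  set n := RingHom.ker χ
  let n' : Ideal R' := n.comap π.toRingHom
  let S := Localization.AtPrime n'
  let P := Localization.AtPrime n
  let F : S →ₐ[k] P := Localization.localAlgHom n' n π rfl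
  have F_algebraMap (r : R') : F (algebraMap R' S r) = algebraMap R P (π r) :=
    Localization.localRingHom_to_map n' n π.toRingHom rfl r
  have hF : Function.Surjective F :=
    RingHom.surjective_localRingHom_of_surjective π.toRingHom hπ n
  let χP : P →ₐ[k] k := IsLocalization.liftAlgHom (M := n.primeCompl) (f := χ)
    fun y => isUnit_iff_ne_zero.mpr y.2
  have hS : ∀ φ : S →ₐ[k] DualNumber k, (∀ s, (φ s).fst = χP (F s)) → ∀ s, F s = 0 → φ s = 0 := by
    intro φ hφ s hs
    obtain ⟨⟨x, y⟩, hxy⟩ := IsLocalization.surj n'.primeCompl s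
    have hx : algebraMap R P (π x) = 0 := by
      rw [← F_algebraMap, ← hxy, map_mul, hs, zero_mul]
    obtain ⟨⟨c, hc⟩, hcx⟩ := (IsLocalization.map_eq_zero_iff n.primeCompl P _).mp hx
    obtain ⟨c, rfl⟩ := hπ c
    have hcx' : φ (algebraMap R' S (c * x)) = 0 :=
      h (φ.comp (IsScalarTower.toAlgHom k R' S)) (fun r => by simp [hφ, F_algebraMap, χP]) _
        (by simpa using hcx)
    have hu (z : n'.primeCompl) : IsUnit (φ (algebraMap R' S z)) :=
      (IsLocalization.map_units S z).map φ
    rw [map_mul, map_mul, (hu ⟨c, hc⟩).mul_right_eq_zero, ← hxy, map_mul,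
      (hu y).mul_left_eq_zero] at hcx'
    exact hcx'
  have : Algebra.FormallySmooth k P := hs
  have hFinj : Function.Injective F := injective_of_formallySmooth hF hS
  refine .of_comp (f := algebraMap R P) ?_
  rw [show algebraMap R P ∘ π = F ∘ algebraMap R' S from funext fun r => (F_algebraMap r).symm]
  exact hFinj.comp (IsLocalization.injective S n'.primeCompl_le_nonZeroDivisors)

theorem ker_eq_of_isSmoothAt {k : Type*} {R' R : Type u} [Field k] [CommRing R'] [CommRing R]
    [Algebra k R'] [Algebra k R] [IsNoetherianRing R'] {P : Ideal R'} [P.IsPrime] {π : R' →ₐ[k] R}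
    (hP : P ≤ RingHom.ker π) (hπ : Function.Surjective π) {χ : R →ₐ[k] k}
    [(RingHom.ker χ).IsPrime] (hs : Algebra.IsSmoothAt k (RingHom.ker χ))
    (h : ∀ φ : R' →ₐ[k] DualNumber k, (∀ r, (φ r).fst = χ (π r)) → P ≤ RingHom.ker φ →
      RingHom.ker π ≤ RingHom.ker φ) : RingHom.ker π = P := by
  have hinj : Function.Injective (Ideal.Quotient.liftₐ P π hP) := by
    refine injective_of_isSmoothAt (Ideal.Quotient.lift_surjective_of_surjective _ hP hπ) hs ?_
    intro φ hφ r hr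
    obtain ⟨r, rfl⟩ := Ideal.Quotient.mk_surjective r
    refine h (φ.comp (Ideal.Quotient.mkₐ k P)) (fun r => hφ (Ideal.Quotient.mk P r)) ?_ hr
    intro p hp
    rw [RingHom.mem_ker, AlgHom.comp_apply, Ideal.Quotient.mkₐ_eq_mk,
      Ideal.Quotient.eq_zero_iff_mem.mpr hp, map_zero]
  exact hP.antisymm' fun r hr => Ideal.Quotient.eq_zero_iff_mem.mp ((map_eq_zero_iff _ hinj).mp hr)

end TangentSurjective

end CommutativeAlgebra

/-! ### Polynomial functions, Zariski closures and tangent spaces -/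

section PolyFun

variable {V W : Type*} [AddCommGroup V] [Module ℂ V] [AddCommGroup W] [Module ℂ W]

/-- A linear form, as a polynomial function. -/
def polyFun.ofDual (f : Module.Dual ℂ V) : polyFun V :=
  ⟨f, Algebra.subset_adjoin ⟨f, rfl⟩⟩

theorem polyFun_induction {P : polyFun V → Prop} (ofDual : ∀ f, P (polyFun.ofDual f))
    (algebraMap : ∀ c, P (algebraMap ℂ _ c)) (add : ∀ p q, P p → P q → P (p + q))
    (mul : ∀ p q, P p → P q → P (p * q)) (p : polyFun V) : P p := by
  obtain ⟨p, hp⟩ := p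
  induction hp using Algebra.adjoin_induction with
  | mem _ hx =>
    obtain ⟨f, rfl⟩ := hx
    exact ofDual f
  | algebraMap c => exact algebraMap c
  | add x y hx hy hpx hpy => exact add ⟨x, hx⟩ ⟨y, hy⟩ hpx hpy
  | mul x y hx hy hpx hpy => exact mul ⟨x, hx⟩ ⟨y, hy⟩ hpx hpy

theorem polyFun_comp_linear {p : V → ℂ} (hp : p ∈ polyFun V) (l : W →ₗ[ℂ] V) :
    p ∘ l ∈ polyFun W := by
  induction hp using Algebra.adjoin_induction with
  | mem _ hx =>
    obtain ⟨f, rfl⟩ := hx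
    exact (polyFun.ofDual (f ∘ₗ l)).2
  | algebraMap r => exact (polyFun W).algebraMap_mem r
  | add _ _ _ _ hx hy => exact (polyFun W).add_mem hx hy
  | mul _ _ _ _ hx hy => exact (polyFun W).mul_mem hx hy

/-- Pullback of polynomial functions along a linear map. -/
def polyFun.pullback (l : W →ₗ[ℂ] V) : polyFun V →ₐ[ℂ] polyFun W where
  toFun p := ⟨p.1 ∘ l, polyFun_comp_linear p.2 l⟩
  map_one' := rfl
  map_mul' _ _ := rfl
  map_zero' := rfl
  map_add' _ _ := rfl
  commutes' _ := rfl

/-- Evaluation of polynomial functions at a vector. -/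
def polyFun.eval (v : V) : polyFun V →ₐ[ℂ] ℂ :=
  (Pi.evalAlgHom ℂ (fun _ : V => ℂ) v).comp (polyFun V).val

instance [FiniteDimensional ℂ V] : Algebra.FiniteType ℂ (polyFun V) := by
  classical
  rw [← Subalgebra.fg_iff_finiteType]
  let b := Module.finBasis ℂ V
  refine ⟨Finset.univ.image fun i => (b.coord i : V → ℂ), ?_⟩
  rw [Finset.coe_image, Finset.coe_univ, Set.image_univ]
  refine le_antisymm (Algebra.adjoin_mono ?_) (Algebra.adjoin_le ?_)
  · rintro _ ⟨i, rfl⟩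
    exact ⟨_, rfl⟩
  · rintro _ ⟨f, rfl⟩
    have hf : (f : V → ℂ) = ∑ i, f (b i) • (b.coord i : V → ℂ) := by
      conv_lhs => rw [← b.sum_dual_apply_smul_coord f, LinearMap.coe_sum]
      rfl
    beta_reduce
    rw [hf]
    exact Subalgebra.sum_mem _ fun i _ =>
      Subalgebra.smul_mem _ (Algebra.subset_adjoin (Set.mem_range_self i)) _

theorem exists_polynomial_eval_eq (p : polyFun V) (v w : V) :
    ∃ q : Polynomial ℂ, ∀ t : ℂ, p.1 (v + t • w) = q.eval t := by
  induction p using polyFun_induction with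
  | ofDual f => exact ⟨.C (f v) + .C (f w) * .X, fun t => by simp [polyFun.ofDual, mul_comm t]⟩
  | algebraMap c => exact ⟨.C c, by simp⟩
  | add p q hp hq =>
    obtain ⟨a, ha⟩ := hp
    obtain ⟨b, hb⟩ := hq
    exact ⟨a + b, fun t => by simp [← ha, ← hb]⟩
  | mul p q hp hq =>
    obtain ⟨a, ha⟩ := hp
    obtain ⟨b, hb⟩ := hq
    exact ⟨a * b, fun t => by simp [← ha, ← hb]⟩

theorem lineDifferentiableAt (p : polyFun V) (v w : V) : LineDifferentiableAt ℂ p.1 v w := by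
  obtain ⟨q, hq⟩ := exists_polynomial_eval_eq p v w
  rw [LineDifferentiableAt, funext hq]
  exact q.differentiableAt

theorem lineDeriv_add (p q : polyFun V) (v w : V) :
    lineDeriv ℂ (p + q).1 v w = lineDeriv ℂ p.1 v w + lineDeriv ℂ q.1 v w :=
  deriv_add (lineDifferentiableAt p v w) (lineDifferentiableAt q v w)

theorem lineDeriv_mul (p q : polyFun V) (v w : V) :
    lineDeriv ℂ (p * q).1 v w = p.1 v * lineDeriv ℂ q.1 v w + q.1 v * lineDeriv ℂ p.1 v w := by
  have := deriv_mul (lineDifferentiableAt p v w) (lineDifferentiableAt q v w)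
  simp only [zero_smul, add_zero] at this
  exact this.trans (by rw [add_comm, mul_comm (q.1 v)]; rfl)

theorem lineDeriv_algebraMap (c : ℂ) (v w : V) :
    lineDeriv ℂ (algebraMap ℂ (polyFun V) c).1 v w = 0 :=
  deriv_const 0 c

theorem lineDeriv_ofDual (f : Module.Dual ℂ V) (v w : V) :
    lineDeriv ℂ (polyFun.ofDual f).1 v w = f w := by
  simp [lineDeriv, polyFun.ofDual]

theorem lineDeriv_pullback (l : W →ₗ[ℂ] V) (p : polyFun V) (v w : W) :
    lineDeriv ℂ (polyFun.pullback l p).1 v w = lineDeriv ℂ p.1 (l v) (l w) := by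
  simp only [lineDeriv, ← map_smul, ← map_add]
  rfl

theorem exists_dual_eq_lineDeriv (p : polyFun V) (v : V) :
    ∃ D : Module.Dual ℂ V, ∀ w, D w = lineDeriv ℂ p.1 v w := by
  induction p using polyFun_induction with
  | ofDual f => exact ⟨f, fun w => (lineDeriv_ofDual f v w).symm⟩
  | algebraMap c => exact ⟨0, fun w => (lineDeriv_algebraMap c v w).symm⟩
  | add p q hp hq =>
    obtain ⟨D, hD⟩ := hp
    obtain ⟨E, hE⟩ := hq
    exact ⟨D + E, fun w => by rw [lineDeriv_add, ← hD, ← hE, LinearMap.add_apply]⟩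
  | mul p q hp hq =>
    obtain ⟨D, hD⟩ := hp
    obtain ⟨E, hE⟩ := hq
    exact ⟨p.1 v • E + q.1 v • D, fun w => by
      rw [lineDeriv_mul, ← hD, ← hE]
      rfl⟩

/-- The differential at `v` of a polynomial function. -/
def differential (p : polyFun V) (v : V) : Module.Dual ℂ V where
  toFun w := lineDeriv ℂ p.1 v w
  map_add' w w' := by
    obtain ⟨D, hD⟩ := exists_dual_eq_lineDeriv p v
    simp only [← hD, map_add]
  map_smul' c w := by
    obtain ⟨D, hD⟩ := exists_dual_eq_lineDeriv p v
    simp only [← hD, map_smul, RingHom.id_apply]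

theorem exists_polyFun_eq_lineDeriv (p : polyFun V) (w : V) :
    ∃ q : polyFun V, ∀ v, q.1 v = lineDeriv ℂ p.1 v w := by
  induction p using polyFun_induction with
  | ofDual f => exact ⟨algebraMap ℂ _ (f w), fun v => (lineDeriv_ofDual f v w).symm⟩
  | algebraMap c => exact ⟨0, fun v => (lineDeriv_algebraMap c v w).symm⟩
  | add p q hp hq =>
    obtain ⟨p', hp'⟩ := hp
    obtain ⟨q', hq'⟩ := hq
    exact ⟨p' + q', fun v => by
      rw [lineDeriv_add, ← hp', ← hq']
      rfl⟩
  | mul p q hp hq =>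
    obtain ⟨p', hp'⟩ := hp
    obtain ⟨q', hq'⟩ := hq
    exact ⟨p * q' + q * p', fun v => by
      rw [lineDeriv_mul, ← hp', ← hq']
      rfl⟩

/-- The homomorphism `ℂ[V] → ℂ[ε]` given by the tangent vector `w` at `v`: it sends `p` to the
first order expansion `p(v + εw)`. -/
def tangentHom (v w : V) : polyFun V →ₐ[ℂ] DualNumber ℂ :=
  dualNumberHom (polyFun.eval v)
    { toFun := fun p => lineDeriv ℂ p.1 v w
      map_add' := fun p q => lineDeriv_add p q v w
      map_smul' := fun c p => by
        rw [Algebra.smul_def, lineDeriv_mul, lineDeriv_algebraMap, mul_zero, add_zero]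
        rfl }
    fun p q => lineDeriv_mul p q v w

theorem fst_tangentHom (v w : V) (p : polyFun V) : (tangentHom v w p).fst = p.1 v :=
  fst_dualNumberHom ..

theorem snd_tangentHom (v w : V) (p : polyFun V) :
    (tangentHom v w p).snd = lineDeriv ℂ p.1 v w :=
  snd_dualNumberHom ..

theorem exists_eq_tangentHom [FiniteDimensional ℂ V] {v : V} {φ : polyFun V →ₐ[ℂ] DualNumber ℂ}
    (h : ∀ p, (φ p).fst = p.1 v) : ∃ w, φ = tangentHom v w := by
  let L : Module.Dual ℂ (Module.Dual ℂ V) :=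
    { toFun := fun f => (φ (polyFun.ofDual f)).snd
      map_add' := fun f g => by
        rw [← TrivSqZeroExt.snd_add, ← map_add]
        rfl
      map_smul' := fun c f => by
        rw [RingHom.id_apply, ← TrivSqZeroExt.snd_smul, ← map_smul]
        rfl }
  refine ⟨(Module.evalEquiv ℂ V).symm L, AlgHom.adjoin_ext ?_⟩
  rintro _ ⟨f, rfl⟩
  change φ (polyFun.ofDual f) = tangentHom v _ (polyFun.ofDual f)
  ext
  · rw [h, fst_tangentHom]
  · rw [snd_tangentHom, lineDeriv_ofDual, Module.apply_evalEquiv_symm_apply]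
    rfl

/-- The ideal of the polynomial functions that vanish on `M`. Thus `M` is irreducible in the Zariski
topology if and only if this ideal is prime. -/
def vanishingIdeal (M : Set V) : Ideal (polyFun V) :=
  ⨅ v ∈ M, RingHom.ker (polyFun.eval v)

theorem mem_vanishingIdeal {M : Set V} {p : polyFun V} :
    p ∈ vanishingIdeal M ↔ ∀ v ∈ M, p.1 v = 0 := by
  simp only [vanishingIdeal, Submodule.mem_iInf]
  rfl

theorem vanishingIdeal_anti {M N : Set V} (h : M ⊆ N) : vanishingIdeal N ≤ vanishingIdeal M :=
  fun _ hp => mem_vanishingIdeal.mpr fun v hv => mem_vanishingIdeal.mp hp v (h hv)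

theorem vanishingIdeal_image (l : W →ₗ[ℂ] V) (M : Set W) :
    vanishingIdeal (l '' M) = (vanishingIdeal M).comap (polyFun.pullback l) := by
  ext p
  simp only [mem_vanishingIdeal, Ideal.mem_comap, Set.forall_mem_image]
  rfl

instance (M : Set W) [(vanishingIdeal M).IsPrime] (l : W →ₗ[ℂ] V) :
    (vanishingIdeal (l '' M)).IsPrime := by
  rw [vanishingIdeal_image]
  infer_instance

theorem nonempty_of_isPrime_vanishingIdeal (M : Set V) [hM : (vanishingIdeal M).IsPrime] :
    M.Nonempty := by
  rw [Set.nonempty_iff_ne_empty]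
  rintro rfl
  exact hM.ne_top (by simp [vanishingIdeal])

theorem mem_zariskiClosure {M : Set V} {v : V} :
    v ∈ zariskiClosure M ↔ ∀ p ∈ vanishingIdeal M, p.1 v = 0 :=
  ⟨fun h p hp => h p p.2 (mem_vanishingIdeal.mp hp),
    fun h p hp hM => h ⟨p, hp⟩ (mem_vanishingIdeal.mpr hM)⟩

theorem subset_zariskiClosure (M : Set V) : M ⊆ zariskiClosure M := fun _ hx _ _ h => h _ hx

theorem vanishingIdeal_zariskiClosure (M : Set V) :
    vanishingIdeal (zariskiClosure M) = vanishingIdeal M :=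
  (vanishingIdeal_anti (subset_zariskiClosure M)).antisymm fun _ hp =>
    mem_vanishingIdeal.mpr fun _ hv => mem_zariskiClosure.mp hv _ hp

theorem zariskiClosure_eq_iff {M N : Set V} :
    zariskiClosure M = zariskiClosure N ↔ vanishingIdeal M = vanishingIdeal N :=
  ⟨fun h => by rw [← vanishingIdeal_zariskiClosure M, h, vanishingIdeal_zariskiClosure],
    fun h => Set.ext fun v => by rw [mem_zariskiClosure, mem_zariskiClosure, h]⟩

theorem mem_tangentSpace {M : Set V} {v w : V} :
    w ∈ tangentSpace M v ↔ ∀ p ∈ vanishingIdeal M, differential p v w = 0 :=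
  ⟨fun h p hp => h p p.2 (mem_vanishingIdeal.mp hp),
    fun h p hp hM => h ⟨p, hp⟩ (mem_vanishingIdeal.mpr hM)⟩

theorem mem_tangentSpace_iff_le_ker {M : Set V} {v : V} (hv : v ∈ M) {w : V} :
    w ∈ tangentSpace M v ↔ vanishingIdeal M ≤ RingHom.ker (tangentHom v w) := by
  rw [mem_tangentSpace]
  refine forall₂_congr fun p hp => ?_
  rw [RingHom.mem_ker, TrivSqZeroExt.ext_iff, fst_tangentHom, snd_tangentHom,
    mem_vanishingIdeal.mp hp v hv]
  simp [differential]

theorem tangentSpace_mono {M N : Set V} (h : vanishingIdeal N ≤ vanishingIdeal M) (v : V) :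
    tangentSpace M v ⊆ tangentSpace N v := fun _ hw =>
  mem_tangentSpace.mpr fun p hp => mem_tangentSpace.mp hw p (h hp)

theorem tangentSpace_congr {M N : Set V} (h : vanishingIdeal M = vanishingIdeal N) (v : V) :
    tangentSpace M v = tangentSpace N v :=
  (tangentSpace_mono h.ge v).antisymm (tangentSpace_mono h.le v)

/-- The tangent space as a linear subspace. -/
def tangentSubmodule (M : Set V) (v : V) : Submodule ℂ V where
  carrier := tangentSpace M v
  add_mem' {w w'} hw hw' := by
    rw [mem_tangentSpace] at hw hw' ⊢
    intro p hp
    rw [map_add, hw p hp, hw' p hp, add_zero]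
  zero_mem' := mem_tangentSpace.mpr fun p _ => map_zero (differential p v)
  smul_mem' c w hw := by
    rw [mem_tangentSpace] at hw ⊢
    intro p hp
    rw [map_smul, hw p hp, smul_zero]

theorem map_mem_tangentSpace {M : Set W} {N : Set V} {l : W →ₗ[ℂ] V} (h : Set.MapsTo l M N)
    {v w : W} (hw : w ∈ tangentSpace M v) : l w ∈ tangentSpace N (l v) := by
  rw [mem_tangentSpace] at hw ⊢
  intro p hp
  rw [mem_vanishingIdeal] at hp
  refine (lineDeriv_pullback l p v w).symm.trans (hw (polyFun.pullback l p) ?_)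
  exact mem_vanishingIdeal.mpr fun x hx => hp _ (h hx)

theorem tangentSubmodule_image_equiv (l : W ≃ₗ[ℂ] V) (M : Set W) (w : W) :
    tangentSubmodule (l.toLinearMap '' M) (l.toLinearMap w) =
      (tangentSubmodule M w).map l.toLinearMap := by
  refine le_antisymm ?_ ?_
  · intro u hu
    have hl : Set.MapsTo l.symm.toLinearMap (l.toLinearMap '' M) M :=
      Set.mapsTo_image_iff.mpr fun w hw => by simpa using hw
    have h := map_mem_tangentSpace hl hu
    rw [LinearEquiv.coe_coe, LinearEquiv.coe_coe, l.symm_apply_apply] at h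
    exact ⟨l.symm u, h, l.apply_symm_apply u⟩
  · rintro _ ⟨u, hu, rfl⟩
    exact map_mem_tangentSpace (l := l.toLinearMap) (Set.mapsTo_image _ M) hu

theorem exists_notMem_forall_tangentSpace_image_subset [FiniteDimensional ℂ V]
    [FiniteDimensional ℂ W] (M : Set W) [(vanishingIdeal M).IsPrime] (l : W →ₗ[ℂ] V) :
    ∃ f ∉ vanishingIdeal M, ∀ m ∈ M, f.1 m ≠ 0 →
      tangentSpace (l '' M) (l m) ⊆ l '' tangentSpace M m := by
  obtain ⟨f, hf, h⟩ :=
    exists_notMem_forall_exists_dualNumber_lift (polyFun.pullback l) (vanishingIdeal M)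
  refine ⟨f, hf, fun m hm hfm w hw => ?_⟩
  rw [mem_tangentSpace_iff_le_ker (Set.mem_image_of_mem l hm), vanishingIdeal_image] at hw
  obtain ⟨φ, hφ, hφm, hφw⟩ := h (polyFun.eval m) (tangentHom (l m) w)
    (fun p hp => mem_vanishingIdeal.mp hp m hm) hfm hw (fst_tangentHom _ _)
  obtain ⟨z, rfl⟩ := exists_eq_tangentHom hφm
  refine ⟨z, (mem_tangentSpace_iff_le_ker hm).mpr hφ, ?_⟩
  rw [← sub_eq_zero, ← Module.forall_dual_apply_eq_zero_iff ℂ]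
  intro g
  have := congr(TrivSqZeroExt.snd ($hφw (polyFun.ofDual g)))
  rw [AlgHom.comp_apply, snd_tangentHom, lineDeriv_pullback, snd_tangentHom, lineDeriv_ofDual,
    lineDeriv_ofDual] at this
  rw [map_sub, this, sub_self]

end PolyFun

section CoordRing

variable {V : Type*} [AddCommGroup V] [Module ℂ V]

theorem coordRing_eq_map (M : Set V) :
    coordRing M = (polyFun V).map (AlgHom.pi fun y : M => Pi.evalAlgHom ℂ (fun _ : V => ℂ) y) := by
  rw [coordRing, polyFun, AlgHom.map_adjoin, ← Set.range_comp]
  rfl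

/-- Restriction of polynomial functions to `M`. -/
def toCoordRing (M : Set V) : polyFun V →ₐ[ℂ] coordRing M :=
  ((AlgHom.pi fun y : M => Pi.evalAlgHom ℂ (fun _ : V => ℂ) y).comp (polyFun V).val).codRestrict _
    fun p => (coordRing_eq_map M).ge ⟨p, p.2, rfl⟩

theorem toCoordRing_surjective (M : Set V) : Function.Surjective (toCoordRing M) := by
  rintro ⟨r, hr⟩
  obtain ⟨p, hp, rfl⟩ := (coordRing_eq_map M).le hr
  exact ⟨⟨p, hp⟩, rfl⟩

theorem ker_toCoordRing (M : Set V) : RingHom.ker (toCoordRing M) = vanishingIdeal M := by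
  ext p
  rw [RingHom.mem_ker, mem_vanishingIdeal, Subtype.ext_iff, funext_iff, Subtype.forall]
  rfl

theorem toCoordRing_eq_zero_iff {M : Set V} {p : polyFun V} :
    toCoordRing M p = 0 ↔ p ∈ vanishingIdeal M := by
  rw [← ker_toCoordRing, RingHom.mem_ker]

instance [FiniteDimensional ℂ V] (M : Set V) : Algebra.FiniteType ℂ (coordRing M) :=
  .of_surjective (toCoordRing M) (toCoordRing_surjective M)

instance (M : Set V) [h : (vanishingIdeal M).IsPrime] : IsDomain (coordRing M) := by
  rw [← ker_toCoordRing] at h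
  exact (Ideal.quotientKerAlgEquivOfSurjective
    (toCoordRing_surjective M)).toMulEquiv.symm.isDomain (polyFun V ⧸ RingHom.ker (toCoordRing M))

variable [FiniteDimensional ℂ V]

theorem exists_notMem_forall_isSmoothPoint (M : Set V) [(vanishingIdeal M).IsPrime] :
    ∃ f ∉ vanishingIdeal M, ∀ m ∈ M, f.1 m ≠ 0 → IsSmoothPoint M m := by
  obtain ⟨f, hf, hs⟩ := exists_ne_zero_smooth_away ℂ (coordRing M) (algebraMap ℂ _).injective
  obtain ⟨f, rfl⟩ := toCoordRing_surjective _ f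
  refine ⟨f, fun h => hf (toCoordRing_eq_zero_iff.mpr h), fun m hm hfm => ⟨hm, ?_⟩⟩
  have : Algebra.FinitePresentation ℂ (coordRing M) :=
    Algebra.FinitePresentation.of_finiteType.mp inferInstance
  have h := Algebra.basicOpen_subset_smoothLocus_iff_smooth.mpr hs
  exact @h ⟨RingHom.ker (evalAt M ⟨m, hm⟩), inferInstance⟩ hfm

theorem vanishingIdeal_eq_of_tangentSpace_subset {Z Z' : Set V} [(vanishingIdeal Z').IsPrime]
    (h : vanishingIdeal Z' ≤ vanishingIdeal Z) {z : V} (hz : IsSmoothPoint Z z)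
    (ht : tangentSpace Z' z ⊆ tangentSpace Z z) : vanishingIdeal Z = vanishingIdeal Z' := by
  obtain ⟨hzZ, hs⟩ := hz
  have : IsNoetherianRing (polyFun V) := Algebra.FiniteType.isNoetherianRing ℂ _
  rw [← ker_toCoordRing Z] at h ⊢
  refine ker_eq_of_isSmoothAt h (toCoordRing_surjective Z) hs fun φ hφ hφZ' => ?_
  obtain ⟨w, rfl⟩ := exists_eq_tangentHom (v := z) hφ
  rw [ker_toCoordRing, ← mem_tangentSpace_iff_le_ker hzZ]
  exact ht (mem_tangentSpace.mpr fun p hp =>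
    (snd_tangentHom z w p).symm.trans congr(TrivSqZeroExt.snd $(hφZ' hp)))

end CoordRing

section Irreducible

variable {V W U : Type*} [AddCommGroup V] [Module ℂ V] [AddCommGroup W] [Module ℂ W]
  [AddCommGroup U] [Module ℂ U]

theorem isPrime_vanishingIdeal_iff {M : Set V} :
    (vanishingIdeal M).IsPrime ↔ M.Nonempty ∧ ∀ p q : polyFun V,
      (∃ m ∈ M, p.1 m ≠ 0) → (∃ m ∈ M, q.1 m ≠ 0) → ∃ m ∈ M, p.1 m ≠ 0 ∧ q.1 m ≠ 0 := by
  have notMem (p : polyFun V) : (∃ m ∈ M, p.1 m ≠ 0) ↔ p ∉ vanishingIdeal M := by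
    simp only [mem_vanishingIdeal, not_forall, exists_prop]
  have notMem_mul (p q : polyFun V) :
      (∃ m ∈ M, p.1 m ≠ 0 ∧ q.1 m ≠ 0) ↔ p * q ∉ vanishingIdeal M := by
    simp only [← notMem, ← mul_ne_zero_iff]
    rfl
  simp only [notMem, notMem_mul]
  refine ⟨fun h => ⟨nonempty_of_isPrime_vanishingIdeal M, fun p q hp hq hpq =>
    (h.mem_or_mem hpq).elim hp hq⟩, fun ⟨⟨m, hm⟩, h⟩ => ⟨?_, fun {p q} hpq => ?_⟩⟩
  · exact (Ideal.ne_top_iff_one _).mpr ((notMem 1).mp ⟨m, hm, one_ne_zero⟩)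
  · by_contra! hpq'
    exact h p q hpq'.1 hpq'.2 hpq

theorem isPrime_vanishingIdeal_of_lineMap_mem {M : Set V} (hM : M.Nonempty)
    (h : ∀ a ∈ M, ∀ b ∈ M, ∀ t : ℂ, a + t • (b - a) ∈ M) : (vanishingIdeal M).IsPrime := by
  refine isPrime_vanishingIdeal_iff.mpr ⟨hM, fun p q ⟨a, ha, hpa⟩ ⟨b, hb, hqb⟩ => ?_⟩
  obtain ⟨P, hP⟩ := exists_polynomial_eval_eq p a (b - a)
  obtain ⟨Q, hQ⟩ := exists_polynomial_eval_eq q a (b - a)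
  have hP0 : P ≠ 0 := by
    rintro rfl
    simpa [hpa] using hP 0
  have hQ0 : Q ≠ 0 := by
    rintro rfl
    simpa [hqb] using hQ 1
  obtain ⟨t, ht⟩ := Polynomial.exists_eval_ne_zero_of_natDegree_lt_card (P * Q)
    (mul_ne_zero hP0 hQ0) (Cardinal.natCast_lt_aleph0.trans_le (Cardinal.aleph0_le_mk ℂ))
  rw [Polynomial.eval_mul, mul_ne_zero_iff, ← hP, ← hQ] at ht
  exact ⟨_, h a ha b hb t, ht⟩

instance (F : V →ₗ[ℂ] W →ₗ[ℂ] U) (M : Set V) (N : Set W) [hM : (vanishingIdeal M).IsPrime]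
    [hN : (vanishingIdeal N).IsPrime] : (vanishingIdeal (Set.image2 (F · ·) M N)).IsPrime := by
  rw [isPrime_vanishingIdeal_iff] at hM hN ⊢
  refine ⟨hM.1.image2 hN.1, ?_⟩
  rintro p q ⟨_, ⟨m₁, hm₁, n₁, hn₁, rfl⟩, hp⟩ ⟨_, ⟨m₂, hm₂, n₂, hn₂, rfl⟩, hq⟩
  obtain ⟨m, hm, hpm, hqm⟩ := hM.2 (polyFun.pullback (F.flip n₁) p)
    (polyFun.pullback (F.flip n₂) q) ⟨m₁, hm₁, hp⟩ ⟨m₂, hm₂, hq⟩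
  obtain ⟨n, hn, hpn⟩ := hN.2 (polyFun.pullback (F m) p) (polyFun.pullback (F m) q)
    ⟨n₁, hn₁, hpm⟩ ⟨n₂, hn₂, hqm⟩
  exact ⟨_, ⟨m, hm, n, hn, rfl⟩, hpn⟩

theorem vanishingIdeal_inter_ne_zero {M : Set V} [h : (vanishingIdeal M).IsPrime] {f : polyFun V}
    (hf : f ∉ vanishingIdeal M) : vanishingIdeal (M ∩ {v | f.1 v ≠ 0}) = vanishingIdeal M := by
  refine le_antisymm (fun p hp => (h.mem_or_mem (x := p) (y := f) ?_).resolve_right hf)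
    (vanishingIdeal_anti Set.inter_subset_left)
  refine mem_vanishingIdeal.mpr fun v hv => ?_
  by_cases hfv : f.1 v = 0
  · exact mul_eq_zero_of_right _ hfv
  · exact mul_eq_zero_of_left (mem_vanishingIdeal.mp hp v ⟨hv, hfv⟩) _

theorem exists_vanishingIdeal_inter_eq {M : Set V} [h : (vanishingIdeal M).IsPrime]
    {s : Set (Set V)} (hs : s.Finite) (hM : M ⊆ ⋃₀ s) :
    ∃ A ∈ s, vanishingIdeal (M ∩ A) = vanishingIdeal M := by
  have hle : hs.toFinset.inf (fun A => vanishingIdeal (M ∩ A)) ≤ vanishingIdeal M := by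
    refine fun p hp => mem_vanishingIdeal.mpr fun v hv => ?_
    obtain ⟨A, hA, hvA⟩ := hM hv
    have hpA : p ∈ vanishingIdeal (M ∩ A) := Finset.inf_le (α := Ideal (polyFun V))
      (f := fun A => vanishingIdeal (M ∩ A)) (hs.mem_toFinset.mpr hA) hp
    exact mem_vanishingIdeal.mp hpA v ⟨hv, hvA⟩
  obtain ⟨A, hA, hAM⟩ := h.inf_le'.mp hle
  exact ⟨A, hs.mem_toFinset.mp hA, hAM.antisymm (vanishingIdeal_anti Set.inter_subset_left)⟩

end Irreducible

section Bilinear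

variable {V : Type*} [AddCommGroup V] [Module ℂ V]

theorem mem_tangentSpace_of_forall_add_smul_mem {M : Set V} {v w : V}
    (h : ∀ t : ℂ, v + t • w ∈ M) : w ∈ tangentSpace M v := fun p _ hM => by
  rw [lineDeriv, show (fun t : ℂ => p (v + t • w)) = fun _ => 0 from funext fun t => hM _ (h t),
    deriv_const]

theorem apply_self_mem_polyFun [FiniteDimensional ℂ V] (C : V →ₗ[ℂ] V →ₗ[ℂ] ℂ) :
    (fun v => C v v) ∈ polyFun V := by
  let b := Module.finBasis ℂ V
  have h : (fun v => C v v) = ∑ i, (b.coord i : V → ℂ) * (C (b i) : V → ℂ) := by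
    ext v
    simpa only [map_sum, map_smul, LinearMap.sum_apply, LinearMap.smul_apply, Finset.sum_apply,
      Pi.mul_apply, Module.Basis.coord_apply, smul_eq_mul]
      using congr(C $((b.sum_repr v).symm) v)
  rw [h]
  exact Subalgebra.sum_mem _ fun i _ =>
    (polyFun V).mul_mem (polyFun.ofDual (b.coord i)).2 (polyFun.ofDual (C (b i))).2

/-- The quadratic form of a bilinear form, as a polynomial function. -/
def polyFun.ofBilin [FiniteDimensional ℂ V] (C : V →ₗ[ℂ] V →ₗ[ℂ] ℂ) : polyFun V :=
  ⟨fun v => C v v, apply_self_mem_polyFun C⟩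

theorem lineDeriv_apply_self (C : V →ₗ[ℂ] V →ₗ[ℂ] ℂ) (v w : V) :
    lineDeriv ℂ (fun v => C v v) v w = C v w + C w v := by
  let q : Polynomial ℂ := .C (C v v) + .C (C v w + C w v) * .X + .C (C w w) * .X ^ 2
  have hq : (fun t : ℂ => C (v + t • w) (v + t • w)) = fun t => q.eval t := by
    ext t
    simp [q]
    ring
  rw [lineDeriv, hq, q.deriv]
  simp [q]

end Bilinear

/-! ### Conormal bundles of orbits -/

section Orbit

variable {Γ R V : Type*} [Group Γ] [Ring R] [AddCommGroup V] [Module R V]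

/-- The orbit of `x` under a group acting through the units of an algebra `R` on an `R`-module.
Both `V` and its dual are such modules, for `R = End V × End V*`, which is how the two actions of
an algebraic group are treated symmetrically. -/
def orbit (τ : Γ →* R) (x : V) : Set V :=
  Set.range fun g => τ g • x

variable (τ : Γ →* R)

theorem map_inv_smul_map_smul (g : Γ) (x : V) : τ g⁻¹ • τ g • x = x := by
  rw [smul_smul, ← map_mul, inv_mul_cancel, map_one, one_smul]

theorem map_smul_map_inv_smul (g : Γ) (x : V) : τ g • τ g⁻¹ • x = x := by
  simpa only [inv_inv] using map_inv_smul_map_smul τ g⁻¹ x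

theorem mem_orbit_self (x : V) : x ∈ orbit τ x :=
  ⟨1, by simp only [map_one, one_smul]⟩

variable {τ}

theorem map_smul_mem_orbit (g : Γ) {x y : V} (h : y ∈ orbit τ x) : τ g • y ∈ orbit τ x := by
  obtain ⟨h, rfl⟩ := h
  exact ⟨g * h, by simp only [map_mul, mul_smul]⟩

theorem orbit_eq_of_mem {x y : V} (h : y ∈ orbit τ x) : orbit τ y = orbit τ x := by
  have subset {x y : V} (h : y ∈ orbit τ x) : orbit τ y ⊆ orbit τ x := by
    rintro _ ⟨g, rfl⟩
    exact map_smul_mem_orbit g h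
  refine (subset h).antisymm (subset ?_)
  obtain ⟨g, rfl⟩ := h
  exact ⟨g⁻¹, map_inv_smul_map_smul τ g x⟩

end Orbit

section Velocities

variable {Γ R V U : Type*} [Group Γ] [Ring R] [Algebra ℂ R]
  [AddCommGroup V] [Module ℂ V] [Module R V] [IsScalarTower ℂ R V]
  [AddCommGroup U] [Module ℂ U] [Module R U] [IsScalarTower ℂ R U]

variable (R V) in
/-- The action of the algebra `R` on the module `V`, as a bilinear map over `ℂ`. -/
def smulBilin : R →ₗ[ℂ] V →ₗ[ℂ] V :=
  (Algebra.lsmul ℂ ℂ V).toLinearMap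

/-- The Zariski tangent space at `1` of the image of `τ`: the Lie algebra of the closure of this
image. Its elements act on vectors as the velocities of the group action. -/
def velocities (τ : Γ →* R) : Set R :=
  tangentSpace (Set.range τ) 1

variable {τ : Γ →* R}

instance [(vanishingIdeal (Set.range τ)).IsPrime] (x : V) :
    (vanishingIdeal (orbit τ x)).IsPrime := by
  rw [show orbit τ x = (smulBilin R V).flip x '' Set.range τ from
    Set.range_comp (fun Y : R => Y • x) τ]
  infer_instance

theorem map_smul_mem_tangentSpace (g : Γ) {x y w : V} (hw : w ∈ tangentSpace (orbit τ x) y) :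
    τ g • w ∈ tangentSpace (orbit τ x) (τ g • y) :=
  map_mem_tangentSpace (l := smulBilin R V (τ g)) (fun _ h => map_smul_mem_orbit g h) hw

theorem smul_mem_tangentSpace {M : Set V} {x : V} (hx : ∀ g, τ g • x ∈ M) {X : R}
    (hX : X ∈ velocities τ) : X • x ∈ tangentSpace M x := by
  have := map_mem_tangentSpace (l := (smulBilin R V).flip x) (N := M)
    (Set.mapsTo_range_iff.mpr hx) hX
  rwa [show (smulBilin R V).flip x 1 = x from one_smul R x] at this

theorem exists_velocity_smul_eq [FiniteDimensional ℂ R] [FiniteDimensional ℂ V]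
    [(vanishingIdeal (Set.range τ)).IsPrime] {x w : V} (hw : w ∈ tangentSpace (orbit τ x) x) :
    ∃ X ∈ velocities τ, X • x = w := by
  obtain ⟨f, hf, h⟩ :=
    exists_notMem_forall_tangentSpace_image_subset (Set.range τ) ((smulBilin R V).flip x)
  obtain ⟨g, hg⟩ : ∃ g, f.1 (τ g) ≠ 0 := by
    simpa [mem_vanishingIdeal] using hf
  rw [← Set.range_comp] at h
  obtain ⟨Z, hZ, hZw⟩ := h _ ⟨g, rfl⟩ hg (map_smul_mem_tangentSpace g hw)
  refine ⟨τ g⁻¹ * Z, ?_, ?_⟩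
  · have := map_mem_tangentSpace (l := LinearMap.mulLeft ℂ (τ g⁻¹)) (N := Set.range τ)
      (Set.mapsTo_range_iff.mpr fun k => ⟨g⁻¹ * k, map_mul ..⟩) hZ
    rwa [LinearMap.mulLeft_apply, LinearMap.mulLeft_apply, ← map_mul, inv_mul_cancel, map_one]
      at this
  · rw [mul_smul, show Z • x = τ g • w from hZw, map_inv_smul_map_smul]

theorem pairing_velocity_add_eq_zero [FiniteDimensional ℂ R] {B : V →ₗ[ℂ] U →ₗ[ℂ] ℂ}
    (hB : ∀ g x ξ, B (τ g • x) (τ g • ξ) = B x ξ) {X : R} (hX : X ∈ velocities τ) (x : V) (ξ : U) :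
    B (X • x) ξ + B x (X • ξ) = 0 := by
  let C : R →ₗ[ℂ] R →ₗ[ℂ] ℂ := B.compl₁₂ ((smulBilin R V).flip x) ((smulBilin R U).flip ξ)
  have hC (Y Z : R) : C Y Z = B (Y • x) (Z • ξ) := rfl
  have h := mem_tangentSpace.mp hX (polyFun.ofBilin C + algebraMap ℂ _ (-B x ξ))
    (mem_vanishingIdeal.mpr <| Set.forall_mem_range.mpr fun g =>
      (congr_arg (· + -B x ξ) (hB g x ξ)).trans (add_neg_cancel _))
  have h' := (lineDeriv_add _ _ _ _).symm.trans h
  rw [lineDeriv_algebraMap, add_zero, polyFun.ofBilin, lineDeriv_apply_self, hC, hC, one_smul,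
    one_smul] at h'
  rwa [add_comm]

end Velocities

section Conormal

variable {Γ R V U : Type*} [Group Γ] [Ring R] [Algebra ℂ R]
  [AddCommGroup V] [Module ℂ V] [AddCommGroup U] [Module ℂ U] {B : V →ₗ[ℂ] U →ₗ[ℂ] ℂ}

/-- The annihilator in `U` of a subset of `V` with respect to a pairing. -/
def annihilator (B : V →ₗ[ℂ] U →ₗ[ℂ] ℂ) (T : Set V) : Submodule ℂ U :=
  ⨅ w ∈ T, LinearMap.ker (B w)

theorem mem_annihilator {T : Set V} {ξ : U} : ξ ∈ annihilator B T ↔ ∀ w ∈ T, B w ξ = 0 := by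
  simp only [annihilator, Submodule.mem_iInf, LinearMap.mem_ker]

theorem finrank_add_finrank_annihilator [FiniteDimensional ℂ V] [B.IsPerfPair]
    (T : Submodule ℂ V) :
    Module.finrank ℂ T + Module.finrank ℂ (annihilator B (T : Set V)) = Module.finrank ℂ V := by
  have h : annihilator B (T : Set V) = T.dualAnnihilator.comap (B.flip.toPerfPair : U →ₗ[ℂ] _) := by
    ext ξ
    rw [mem_annihilator, Submodule.mem_comap, Submodule.mem_dualAnnihilator]
    rfl
  rw [h, Submodule.comap_equiv_eq_map_symm, LinearEquiv.finrank_map_eq,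
    Subspace.finrank_add_finrank_dualAnnihilator_eq]

theorem finrank_eq_finrank_map_fst_add_finrank_comap_inr [FiniteDimensional ℂ V]
    [FiniteDimensional ℂ U] (S : Submodule ℂ (V × U)) :
    Module.finrank ℂ S = Module.finrank ℂ (S.map (LinearMap.fst ℂ V U)) +
      Module.finrank ℂ (S.comap (LinearMap.inr ℂ V U)) := by
  have h := ((LinearMap.fst ℂ V U).domRestrict S).finrank_range_add_finrank_ker
  have hker : ((S.comap (LinearMap.inr ℂ V U)).map (LinearMap.inr ℂ V U)) =
      (LinearMap.ker ((LinearMap.fst ℂ V U).domRestrict S)).map S.subtype := by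
    rw [LinearMap.ker_domRestrict, Submodule.map_comap_subtype, Submodule.map_comap_eq,
      LinearMap.range_inr, inf_comm]
  rw [LinearMap.range_domRestrict] at h
  have heq := Submodule.equivMapOfInjective (LinearMap.inr ℂ V U) LinearMap.inr_injective
  rw [← h, (heq _).finrank_eq, hker, Submodule.finrank_map_subtype_eq]

/-- The conormal bundle of `O ⊆ V`. -/
def conormal (B : V →ₗ[ℂ] U →ₗ[ℂ] ℂ) (O : Set V) : Set (V × U) :=
  {z | z.1 ∈ O ∧ z.2 ∈ annihilator B (tangentSpace O z.1)}

variable [Module R V] [IsScalarTower ℂ R V] {τ : Γ →* R}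

theorem mem_annihilator_tangentSpace_orbit_iff [FiniteDimensional ℂ R] [FiniteDimensional ℂ V]
    [(vanishingIdeal (Set.range τ)).IsPrime] {x : V} {ξ : U} :
    ξ ∈ annihilator B (tangentSpace (orbit τ x) x) ↔ ∀ X ∈ velocities τ, B (X • x) ξ = 0 := by
  rw [mem_annihilator]
  refine ⟨fun h X hX => h _ (smul_mem_tangentSpace Set.mem_range_self hX), fun h w hw => ?_⟩
  obtain ⟨X, hX, rfl⟩ := exists_velocity_smul_eq hw
  exact h X hX

theorem comap_inr_tangentSubmodule_conormal [FiniteDimensional ℂ R] [FiniteDimensional ℂ V]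
    [FiniteDimensional ℂ U] [(vanishingIdeal (Set.range τ)).IsPrime] {x : V} {ξ : U}
    (hξ : ξ ∈ annihilator B (tangentSpace (orbit τ x) x)) :
    (tangentSubmodule (conormal B (orbit τ x)) (x, ξ)).comap (LinearMap.inr ℂ V U) =
      annihilator B (tangentSpace (orbit τ x) x) := by
  refine le_antisymm (fun ζ hζ => ?_) fun ζ hζ => ?_
  · refine mem_annihilator_tangentSpace_orbit_iff.mpr fun X hX => ?_
    let C : V × U →ₗ[ℂ] V × U →ₗ[ℂ] ℂ :=
      B.compl₁₂ (smulBilin R V X ∘ₗ LinearMap.fst ℂ V U) (LinearMap.snd ℂ V U)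
    have hC : polyFun.ofBilin C ∈ vanishingIdeal (conormal B (orbit τ x)) := by
      refine mem_vanishingIdeal.mpr fun z hz => ?_
      refine mem_annihilator_tangentSpace_orbit_iff.mp ?_ X hX
      exact (orbit_eq_of_mem hz.1).symm ▸ hz.2
    have h : C (x, ξ) (0, ζ) + C (0, ζ) (x, ξ) = 0 :=
      (lineDeriv_apply_self C _ _).symm.trans
        (hζ _ (polyFun.ofBilin C).2 (mem_vanishingIdeal.mp hC))
    simpa [C, smulBilin] using h
  · refine mem_tangentSpace_of_forall_add_smul_mem fun t => ⟨?_, ?_⟩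
    · simpa using mem_orbit_self τ x
    · simpa using Submodule.add_mem _ hξ (Submodule.smul_mem _ t hζ)

variable [Module R U]

theorem map_smul_mem_conormal (hB : ∀ g x ξ, B (τ g • x) (τ g • ξ) = B x ξ) (g : Γ) {x : V}
    {z : V × U} (hz : z ∈ conormal B (orbit τ x)) : τ g • z ∈ conormal B (orbit τ x) := by
  refine ⟨map_smul_mem_orbit g hz.1, mem_annihilator.mpr fun w hw => ?_⟩
  have hw' := map_smul_mem_tangentSpace g⁻¹ hw
  rw [Prod.smul_fst, map_inv_smul_map_smul] at hw'
  rw [Prod.smul_snd, ← map_smul_map_inv_smul τ g w, hB]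
  exact mem_annihilator.mp hz.2 _ hw'

variable [IsScalarTower ℂ R U]

theorem conormal_orbit_eq_image2 (hB : ∀ g x ξ, B (τ g • x) (τ g • ξ) = B x ξ) (x : V) :
    conormal B (orbit τ x) = Set.image2 (smulBilin R (V × U) · ·) (Set.range τ)
      ({x} ×ˢ annihilator B (tangentSpace (orbit τ x) x)) := by
  refine Set.Subset.antisymm ?_ ?_
  · rintro ⟨y, ξ⟩ hz
    obtain ⟨g, rfl⟩ := hz.1
    have hz' := map_smul_mem_conormal hB g⁻¹ hz
    rw [Prod.smul_mk, map_inv_smul_map_smul] at hz'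
    exact ⟨τ g, ⟨g, rfl⟩, (x, τ g⁻¹ • ξ), Set.mk_mem_prod rfl hz'.2,
      congr_arg (Prod.mk _) (map_smul_map_inv_smul τ g ξ)⟩
  · rintro _ ⟨_, ⟨g, rfl⟩, ⟨_, ξ⟩, ⟨rfl, hξ⟩, rfl⟩
    exact map_smul_mem_conormal hB g ⟨mem_orbit_self τ _, hξ⟩

theorem isPrime_vanishingIdeal_conormal [(vanishingIdeal (Set.range τ)).IsPrime]
    (hB : ∀ g x ξ, B (τ g • x) (τ g • ξ) = B x ξ) (x : V) :
    (vanishingIdeal (conormal B (orbit τ x))).IsPrime := by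
  set A := annihilator B (tangentSpace (orbit τ x) x)
  have : (vanishingIdeal ({x} ×ˢ (A : Set U))).IsPrime := by
    refine isPrime_vanishingIdeal_of_lineMap_mem ⟨(x, 0), rfl, A.zero_mem⟩ ?_
    rintro ⟨_, ξ⟩ ⟨rfl, hξ⟩ ⟨_, ζ⟩ ⟨rfl, hζ⟩ t
    exact ⟨by simp, A.add_mem hξ (A.smul_mem t (A.sub_mem hζ hξ))⟩
  rw [conormal_orbit_eq_image2 hB]
  infer_instance

variable [FiniteDimensional ℂ R] [FiniteDimensional ℂ V]
  [(vanishingIdeal (Set.range τ)).IsPrime]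

theorem mem_annihilator_tangentSpace_orbit_comm [FiniteDimensional ℂ U]
    (hB : ∀ g x ξ, B (τ g • x) (τ g • ξ) = B x ξ) {x : V} {ξ : U} :
    ξ ∈ annihilator B (tangentSpace (orbit τ x) x) ↔
      x ∈ annihilator B.flip (tangentSpace (orbit τ ξ) ξ) := by
  rw [mem_annihilator_tangentSpace_orbit_iff, mem_annihilator_tangentSpace_orbit_iff]
  refine forall₂_congr fun X hX => ?_
  rw [eq_neg_of_add_eq_zero_left (pairing_velocity_add_eq_zero hB hX x ξ), neg_eq_zero]
  rfl

theorem map_fst_tangentSubmodule_conormal (hB : ∀ g x ξ, B (τ g • x) (τ g • ξ) = B x ξ) {x : V}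
    {ξ : U} (hξ : ξ ∈ annihilator B (tangentSpace (orbit τ x) x)) :
    (tangentSubmodule (conormal B (orbit τ x)) (x, ξ)).map (LinearMap.fst ℂ V U) =
      tangentSubmodule (orbit τ x) x := by
  refine le_antisymm (Submodule.map_le_iff_le_comap.mpr fun w hw => ?_) fun w hw => ?_
  · exact map_mem_tangentSpace (l := LinearMap.fst ℂ V U) (fun _ hz => hz.1) hw
  · obtain ⟨X, hX, rfl⟩ := exists_velocity_smul_eq hw
    exact ⟨X • (x, ξ), smul_mem_tangentSpace (x := (x, ξ))
      (fun g => map_smul_mem_conormal hB g ⟨mem_orbit_self τ x, hξ⟩) hX, rfl⟩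

theorem finrank_tangentSubmodule_conormal [FiniteDimensional ℂ U] [B.IsPerfPair]
    (hB : ∀ g x ξ, B (τ g • x) (τ g • ξ) = B x ξ) {x : V} {z : V × U}
    (hz : z ∈ conormal B (orbit τ x)) :
    Module.finrank ℂ (tangentSubmodule (conormal B (orbit τ x)) z) = Module.finrank ℂ V := by
  obtain ⟨y, ξ⟩ := z
  have hy : orbit τ y = orbit τ x := orbit_eq_of_mem hz.1
  have hξ : ξ ∈ annihilator B (tangentSpace (orbit τ y) y) := by
    rw [hy]
    exact hz.2
  rw [← hy, finrank_eq_finrank_map_fst_add_finrank_comap_inr,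
    map_fst_tangentSubmodule_conormal hB hξ, comap_inr_tangentSubmodule_conormal hξ]
  exact finrank_add_finrank_annihilator (tangentSubmodule (orbit τ y) y)

end Conormal

section ConormalDual

variable {V U : Type*} [AddCommGroup V] [Module ℂ V] [AddCommGroup U] [Module ℂ U]
  {B : V →ₗ[ℂ] U →ₗ[ℂ] ℂ} {O : Set V} {O' : Set U}

variable (B O') in
/-- The conormal bundle of `O' ⊆ U`, with its factors swapped so that it lies in the same space
`V × U` as the conormal bundles of subsets of `V`. -/
def dualConormal : Set (V × U) :=
  (LinearEquiv.prodComm ℂ U V).toLinearMap '' conormal B.flip O'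

theorem image_prodComm_dualConormal :
    (LinearEquiv.prodComm ℂ V U).toLinearMap '' dualConormal B O' = conormal B.flip O' := by
  rw [dualConormal, Set.image_image]
  exact Set.image_id _

variable (B O O') in
/-- The duality of orbits: the conormal bundles of `O ⊆ V` and `O' ⊆ U` have the same Zariski
closure in `V × U`. -/
def IsConormalDual : Prop :=
  vanishingIdeal (conormal B O) = vanishingIdeal (dualConormal B O')

theorem IsConormalDual.symm (h : IsConormalDual B O O') : IsConormalDual B.flip O' O := by
  rw [IsConormalDual, ← image_prodComm_dualConormal, vanishingIdeal_image, ← h,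
    ← vanishingIdeal_image, dualConormal, LinearMap.flip_flip]

theorem IsConormalDual.vanishingIdeal_image_snd (h : IsConormalDual B O O') :
    vanishingIdeal (Prod.snd '' conormal B O) = vanishingIdeal O' := by
  have hO' : LinearMap.snd ℂ V U '' dualConormal B O' = O' := by
    rw [dualConormal, Set.image_image]
    exact Set.Subset.antisymm (Set.image_subset_iff.mpr fun _ hz => hz.1)
      fun ξ hξ => ⟨(ξ, 0), ⟨hξ, Submodule.zero_mem _⟩, rfl⟩
  calc vanishingIdeal (LinearMap.snd ℂ V U '' conormal B O)
      = vanishingIdeal (LinearMap.snd ℂ V U '' dualConormal B O') := by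
        rw [vanishingIdeal_image, vanishingIdeal_image, h]
    _ = vanishingIdeal O' := by rw [hO']

end ConormalDual

section Duality

variable {Γ R V U : Type*} [Group Γ] [Ring R] [Algebra ℂ R] [FiniteDimensional ℂ R]
  [AddCommGroup V] [Module ℂ V] [FiniteDimensional ℂ V] [Module R V] [IsScalarTower ℂ R V]
  [AddCommGroup U] [Module ℂ U] [FiniteDimensional ℂ U] [Module R U] [IsScalarTower ℂ R U]
  {τ : Γ →* R} [(vanishingIdeal (Set.range τ)).IsPrime]
  {B : V →ₗ[ℂ] U →ₗ[ℂ] ℂ}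

theorem mem_conormal_of_mem_dualConormal (hB : ∀ g x ξ, B (τ g • x) (τ g • ξ) = B x ξ) {x : V}
    {ξ : U} {z : V × U} (hz : z ∈ dualConormal B (orbit τ ξ)) (hx : z.1 ∈ orbit τ x) :
    z ∈ conormal B (orbit τ x) := by
  obtain ⟨⟨ζ, y⟩, ⟨hζ, hy⟩, rfl⟩ := hz
  refine ⟨hx, ?_⟩
  rw [← orbit_eq_of_mem hx]
  rw [← orbit_eq_of_mem hζ] at hy
  exact (mem_annihilator_tangentSpace_orbit_comm hB).mpr hy

variable [B.IsPerfPair]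

theorem finrank_tangentSubmodule_dualConormal
    (hB : ∀ g x ξ, B (τ g • x) (τ g • ξ) = B x ξ) {ξ : U} {z : V × U}
    (hz : z ∈ dualConormal B (orbit τ ξ)) :
    Module.finrank ℂ (tangentSubmodule (dualConormal B (orbit τ ξ)) z) = Module.finrank ℂ V := by
  obtain ⟨z, hz, rfl⟩ := hz
  rw [dualConormal, tangentSubmodule_image_equiv, LinearEquiv.finrank_map_eq,
    finrank_tangentSubmodule_conormal (fun g ζ y => hB g y ζ) hz,
    B.flip.toPerfPair.finrank_eq, Subspace.dual_finrank_eq]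

theorem exists_isConormalDual_orbit (hB : ∀ g x ξ, B (τ g • x) (τ g • ξ) = B x ξ)
    (hfin : (Set.range (orbit τ : V → Set V)).Finite) (ξ : U) :
    ∃ x : V, IsConormalDual B (orbit τ x) (orbit τ ξ) := by
  set N := dualConormal B (orbit τ ξ) with hN
  have : (vanishingIdeal (conormal B.flip (orbit τ ξ))).IsPrime :=
    isPrime_vanishingIdeal_conormal (fun g ζ y => hB g y ζ) ξ
  have : (vanishingIdeal N).IsPrime := by
    rw [hN, dualConormal]
    infer_instance
  obtain ⟨f, hf, hsmooth⟩ := exists_notMem_forall_isSmoothPoint N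
  have hNf := vanishingIdeal_inter_ne_zero hf
  have : (vanishingIdeal (N ∩ {z | f.1 z ≠ 0})).IsPrime := hNf ▸ inferInstance
  obtain ⟨_, ⟨_, ⟨x, rfl⟩, rfl⟩, hA⟩ := exists_vanishingIdeal_inter_eq
    (M := N ∩ {z | f.1 z ≠ 0}) (hfin.image (Prod.fst ⁻¹' · : Set V → Set (V × U)))
    fun z _ => ⟨_, Set.mem_image_of_mem _ ⟨z.1, rfl⟩, mem_orbit_self τ z.1⟩
  have hAN := hA.trans hNf
  have hle : N ∩ {z | f.1 z ≠ 0} ∩ Prod.fst ⁻¹' orbit τ x ⊆ conormal B (orbit τ x) :=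
    fun z hz => mem_conormal_of_mem_dualConormal hB hz.1.1 hz.2
  have : (vanishingIdeal (N ∩ {z | f.1 z ≠ 0} ∩ Prod.fst ⁻¹' orbit τ x)).IsPrime :=
    hAN ▸ inferInstance
  obtain ⟨z, hz⟩ :=
    nonempty_of_isPrime_vanishingIdeal (N ∩ {z | f.1 z ≠ 0} ∩ Prod.fst ⁻¹' orbit τ x)
  have hNx : vanishingIdeal (conormal B (orbit τ x)) ≤ vanishingIdeal N :=
    (vanishingIdeal_anti hle).trans hAN.le
  have hT : tangentSubmodule N z ≤ tangentSubmodule (conormal B (orbit τ x)) z :=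
    tangentSpace_mono hNx z
  have := isPrime_vanishingIdeal_conormal hB x
  refine ⟨x, (vanishingIdeal_eq_of_tangentSpace_subset hNx (hsmooth z hz.1.1 hz.1.2) ?_).symm⟩
  refine (Submodule.eq_of_le_of_finrank_eq hT ?_).ge
  rw [finrank_tangentSubmodule_dualConormal hB hz.1.1,
    finrank_tangentSubmodule_conormal hB (hle hz)]

theorem exists_equiv_orbit_isConormalDual (hB : ∀ g x ξ, B (τ g • x) (τ g • ξ) = B x ξ)
    (hfin : (Set.range (orbit τ : V → Set V)).Finite)
    (hV : Set.InjOn vanishingIdeal (Set.range (orbit τ : V → Set V)))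
    (hU : Set.InjOn vanishingIdeal (Set.range (orbit τ : U → Set U))) :
    (Set.range (orbit τ : U → Set U)).Finite ∧
      ∃ e : Set.range (orbit τ : V → Set V) ≃ Set.range (orbit τ : U → Set U),
        ∀ O : Set.range (orbit τ : V → Set V), IsConormalDual B (O : Set V) (e O : Set U) := by
  have hex (O' : Set.range (orbit τ : U → Set U)) :
      ∃ O : Set.range (orbit τ : V → Set V), IsConormalDual B (O : Set V) (O' : Set U) := by
    obtain ⟨_, ξ, rfl⟩ := O'
    obtain ⟨x, hx⟩ := exists_isConormalDual_orbit hB hfin ξ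
    exact ⟨⟨_, x, rfl⟩, hx⟩
  choose b hb using hex
  have hb_inj : Function.Injective b := fun O₁ O₂ h => Subtype.ext <| hU O₁.2 O₂.2 <| by
    rw [← (hb O₁).vanishingIdeal_image_snd, h, (hb O₂).vanishingIdeal_image_snd]
  have := hfin.to_subtype
  have hfin' : (Set.range (orbit τ : U → Set U)).Finite :=
    Set.finite_coe_iff.mp (Finite.of_injective b hb_inj)
  have hb_surj : Function.Surjective b := by
    rintro ⟨_, x, rfl⟩
    obtain ⟨ξ, hξ⟩ := exists_isConormalDual_orbit (B := B.flip) (fun g ζ y => hB g y ζ) hfin' x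
    refine ⟨⟨_, ξ, rfl⟩, Subtype.ext (hV (b _).2 ⟨x, rfl⟩ ?_)⟩
    rw [← (hb ⟨_, ξ, rfl⟩).symm.vanishingIdeal_image_snd, hξ.vanishingIdeal_image_snd]
  let e := Equiv.ofBijective b ⟨hb_inj, hb_surj⟩
  refine ⟨hfin', e.symm, fun O => ?_⟩
  have h := hb (e.symm O)
  rwa [show b (e.symm O) = O from e.apply_symm_apply O] at h

end Duality

/-! ### Connected algebraic groups and their affine charts -/

section Irreducible

theorem irreducibleSpace_of_forall_exists_isOpen {X : Type*} [TopologicalSpace X]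
    [ConnectedSpace X] (h : ∀ x : X, ∃ W : Set X, IsOpen W ∧ x ∈ W ∧ IsIrreducible W) :
    IrreducibleSpace X := by
  obtain ⟨x₀⟩ := (inferInstance : Nonempty X)
  have hirr : IsIrreducible (irreducibleComponent x₀) := isIrreducible_irreducibleComponent
  have hopen : IsOpen (irreducibleComponent x₀) := by
    refine isOpen_iff_forall_mem_open.mpr fun x hx => ?_
    obtain ⟨W, hW, hxW, hWirr⟩ := h x
    have hle : irreducibleComponent x₀ ⊆ closure W :=
      (subset_closure_inter_of_isPreirreducible_of_isOpen hirr.2 hW ⟨x, hx, hxW⟩).trans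
        (closure_mono Set.inter_subset_right)
    have hW' := eq_irreducibleComponent hWirr.isPreirreducible.closure hle
    exact ⟨W, subset_closure.trans hW'.le, hW, hxW⟩
  rw [IsClopen.eq_univ ⟨isClosed_irreducibleComponent, hopen⟩
    ⟨x₀, mem_irreducibleComponent⟩] at hirr
  exact (irreducibleSpace_def X).mpr hirr

theorem exists_isOpen_isIrreducible (X : Type*) [TopologicalSpace X]
    [TopologicalSpace.NoetherianSpace X] [Nonempty X] :
    ∃ W : Set X, IsOpen W ∧ IsIrreducible W := by
  obtain ⟨x⟩ := (inferInstance : Nonempty X)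
  obtain ⟨W, hW, hWne, hWx⟩ :=
    TopologicalSpace.NoetherianSpace.exists_isOpen_nonempty_subset_irreducibleComponent
      _ (irreducibleComponent_mem_irreducibleComponents x)
  exact ⟨W, hW, hWne, isIrreducible_irreducibleComponent.isPreirreducible.open_subset hW hWx⟩

variable (G : Over (Spec (.of ℂ)))

theorem exists_points_apply_mem [LocallyOfFiniteType G.hom] [JacobsonSpace G.left] {Z : Set G.left}
    (hZ : IsLocallyClosed Z) (hne : Z.Nonempty) :
    ∃ g : Points G, g.left (IsLocalRing.closedPoint ℂ) ∈ Z := by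
  obtain ⟨x, hxZ, hx⟩ := nonempty_inter_closedPoints hne hZ
  let p := (pointEquivClosedPoint G.hom).symm ⟨x, hx⟩
  have hp : p.1 (IsLocalRing.closedPoint ℂ) = x :=
    congr_arg Subtype.val ((pointEquivClosedPoint G.hom).apply_symm_apply ⟨x, hx⟩)
  refine ⟨Over.homMk p.1 p.2, ?_⟩
  change p.1 (IsLocalRing.closedPoint ℂ) ∈ Z
  rwa [hp]

variable {G} in
open CartesianMonoidalCategory in
theorem exists_iso_comp_hom_eq [GrpObj G] (g h : Points G) : ∃ α : G ≅ G, g ≫ α.hom = h := by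
  refine ⟨(GrpObj.mulRight g).symm ≪≫ GrpObj.mulRight h, ?_⟩
  rw [Iso.trans_hom, Iso.symm_hom, ← Category.assoc, ← Iso.eq_comp_inv]
  simp [comp_lift_assoc]

theorem irreducibleSpace_left [GrpObj G] [LocallyOfFiniteType G.hom] [QuasiCompact G.hom]
    [ConnectedSpace G.left] : IrreducibleSpace G.left := by
  have := LocallyOfFiniteType.jacobsonSpace G.hom
  have : CompactSpace G.left := (quasiCompact_iff_compactSpace (f := G.hom)).mp inferInstance
  have : IsNoetherian G.left := { __ := LocallyOfFiniteType.isLocallyNoetherian G.hom }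
  obtain ⟨W, hW, hWirr⟩ := exists_isOpen_isIrreducible G.left
  obtain ⟨g, hg⟩ := exists_points_apply_mem G hW.isLocallyClosed hWirr.1
  refine irreducibleSpace_of_forall_exists_isOpen fun x => ?_
  obtain ⟨h, hh⟩ := exists_points_apply_mem G isClosed_closure.isLocallyClosed
    (closure_nonempty_iff.mpr (Set.singleton_nonempty x))
  obtain ⟨α, rfl⟩ := exists_iso_comp_hom_eq h g
  have : IsIso α.hom.left := inferInstanceAs (IsIso ((Over.forget _).map α.hom))
  have hαW := hW.preimage α.hom.left.continuous
  refine ⟨α.hom.left ⁻¹' W, hαW, ?_, ⟨_, hg⟩,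
    hWirr.isPreirreducible.preimage α.hom.left.isOpenEmbedding⟩
  obtain ⟨z, hz, rfl⟩ := mem_closure_iff.mp hh _ hαW hg
  exact hz

end Irreducible

section Chart

theorem basicOpen_eq_bot_of_appTop_eq_zero {X Y : Scheme} (f : Y ⟶ X) [IsDominant f]
    {s : Γ(X, ⊤)} (hs : f.appTop s = 0) : X.basicOpen s = ⊥ := by
  by_contra h
  obtain ⟨y, hy⟩ := f.denseRange.exists_mem_open (X.basicOpen s).2
    ((TopologicalSpace.Opens.ne_bot_iff_nonempty _).mp h)
  have hbot : f ⁻¹ᵁ X.basicOpen s = ⊥ := by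
    rw [Scheme.preimage_basicOpen_top, hs, Scheme.basicOpen_zero]
  exact hbot.le (show y ∈ f ⁻¹ᵁ X.basicOpen s from hy)

theorem exists_isDominant_spec {X : Scheme} [IrreducibleSpace X] {R : CommRingCat}
    (p : X ⟶ Spec R) [LocallyOfFiniteType p] :
    ∃ (A : Type) (_ : CommRing A) (_ : IsDomain A) (_ : Algebra R A) (_ : Algebra.FiniteType R A)
      (f : Spec (.of A) ⟶ X), IsDominant f ∧
        f ≫ p = Spec.map (CommRingCat.ofHom (algebraMap R A)) := by
  obtain ⟨x⟩ := (inferInstance : Nonempty X)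
  obtain ⟨_, ⟨U, hU, rfl⟩, hxU, -⟩ :=
    X.isBasis_affineOpens.exists_subset_of_mem_open (Set.mem_univ x) isOpen_univ
  let j : Spec Γ(X, U) ⟶ X := hU.fromSpec
  have hj : IsOpenImmersion j := hU.isOpenImmersion_fromSpec
  have hrange : Set.range j = U := hU.range_fromSpec
  have hdom : IsDominant j := ⟨by
    rw [DenseRange, hrange]
    exact U.2.dense ⟨x, hxU⟩⟩
  let c : R ⟶ Γ(X, U) := Spec.preimage (j ≫ p)
  have hc : Spec.map c = j ≫ p := Spec.map_preimage _
  let : Algebra R Γ(X, U) := c.hom.toAlgebra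
  have hft : Algebra.FiniteType R Γ(X, U) := by
    have : LocallyOfFiniteType (Spec.map c) := hc ▸ inferInstance
    exact (HasRingHomProperty.Spec_iff (P := @LocallyOfFiniteType)).mp this
  have hprime : (nilradical Γ(X, U)).IsPrime := by
    obtain ⟨y, -⟩ : x ∈ Set.range j := hrange ▸ hxU
    rw [← PrimeSpectrum.irreducibleSpace_iff_isPrime_nilradical, irreducibleSpace_def]
    exact ⟨⟨y, trivial⟩,
      (PreirreducibleSpace.isPreirreducible_univ (X := X)).preimage j.isOpenEmbedding⟩
  let q := CommRingCat.ofHom (Ideal.Quotient.mk (nilradical Γ(X, U)))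
  have hq : Surjective (Spec.map q) :=
    ⟨(PrimeSpectrum.comap_quotientMk_bijective_of_le_nilradical le_rfl).2⟩
  exact ⟨Γ(X, U) ⧸ nilradical Γ(X, U), inferInstance, inferInstance, inferInstance, inferInstance,
    Spec.map q ≫ j, inferInstance, by rw [Category.assoc, ← hc, ← Spec.map_comp]; rfl⟩

end Chart

/-! ### Regular maps -/

section RegularFun

variable {G : Over (Spec (.of ℂ))}

theorem evalPoint_eq_zero_of_appTop_eq_zero {Y : Scheme} (f : Y ⟶ G.left) [IsDominant f]
    {s : Γ(G.left, ⊤)} (hs : f.appTop s = 0) (g : Points G) : evalPoint g s = 0 := by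
  have hbot : (Spec (.of ℂ)).basicOpen (g.left.appTop s) = ⊥ := by
    rw [← Scheme.preimage_basicOpen_top, basicOpen_eq_bot_of_appTop_eq_zero f hs]
    rfl
  have hnil : IsNilpotent (g.left.appTop s) :=
    (Scheme.isNilpotent_iff_basicOpen_eq_bot (X := Spec (.of ℂ)) _).mpr hbot
  exact (hnil.map (Scheme.ΓSpecIso (.of ℂ)).hom.hom).eq_zero

theorem evalPoint_const (g : Points G) (c : ℂ) :
    evalPoint g (G.hom.appTop ((Scheme.ΓSpecIso (.of ℂ)).inv c)) = c := by
  have hg : G.hom.appTop ≫ g.left.appTop = 𝟙 _ := by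
    rw [← Scheme.Hom.comp_appTop, Over.w g]
    exact Scheme.Hom.id_appTop
  have hgc := congr($hg ((Scheme.ΓSpecIso (.of ℂ)).inv c))
  change (Scheme.ΓSpecIso (.of ℂ)).hom ((G.hom.appTop ≫ g.left.appTop) _) = c
  rw [hgc]
  simp

variable (G) in
/-- The algebra of regular functions on the complex points of `G`. -/
def regularFun : Subalgebra ℂ (Points G → ℂ) where
  carrier := {φ | ∃ s : Γ(G.left, ⊤), ∀ g, φ g = evalPoint g s}
  mul_mem' := by
    rintro _ _ ⟨s, hs⟩ ⟨t, ht⟩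
    exact ⟨s * t, fun g => by simp [hs, ht, evalPoint]⟩
  add_mem' := by
    rintro _ _ ⟨s, hs⟩ ⟨t, ht⟩
    exact ⟨s + t, fun g => by simp [hs, ht, evalPoint]⟩
  algebraMap_mem' c := ⟨_, fun g => (evalPoint_const g c).symm⟩

theorem exists_injective_regularFun_algHom (G : Over (Spec (.of ℂ))) [LocallyOfFiniteType G.hom]
    [IrreducibleSpace G.left] :
    ∃ (A : Type) (_ : CommRing A) (_ : IsDomain A) (_ : Algebra ℂ A) (_ : Algebra.FiniteType ℂ A)
      (pt : (A →ₐ[ℂ] ℂ) → Points G) (Φ : regularFun G →ₐ[ℂ] A), Function.Injective Φ ∧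
        ∀ (χ : A →ₐ[ℂ] ℂ) (φ : regularFun G), χ (Φ φ) = φ.1 (pt χ) := by
  obtain ⟨A, _, _, _, _, f, _, hf⟩ := exists_isDominant_spec G.hom
  let pt (χ : A →ₐ[ℂ] ℂ) : Points G :=
    Over.homMk (Spec.map (CommRingCat.ofHom χ.toRingHom) ≫ f) <| by
      rw [Category.assoc, hf, ← Spec.map_comp, ← CommRingCat.ofHom_comp]
      exact (congr_arg (fun a => Spec.map (CommRingCat.ofHom a)) χ.comp_algebraMap).trans
        (Spec.map_id _)
  let r (s : Γ(G.left, ⊤)) : A := (Scheme.ΓSpecIso (.of A)).hom (f.appTop s)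
  have hr (χ : A →ₐ[ℂ] ℂ) (s : Γ(G.left, ⊤)) : χ (r s) = evalPoint (pt χ) s := by
    have hχ := Scheme.ΓSpecIso_naturality (CommRingCat.ofHom χ.toRingHom)
    change _ = (Scheme.ΓSpecIso (.of ℂ)).hom ((Spec.map _ ≫ f).appTop s)
    rw [Scheme.Hom.comp_appTop]
    exact congr($hχ (f.appTop s)).symm
  obtain ⟨Φ, hΦ⟩ := exists_algHom_forall_apply_eq
    (fun χ => (Pi.evalAlgHom ℂ (fun _ : Points G => ℂ) (pt χ)).comp (regularFun G).val)
    fun ⟨φ, s, hs⟩ => ⟨r s, fun χ => (hr χ s).trans (hs _).symm⟩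
  refine ⟨A, _, ‹_›, _, ‹_›, pt, Φ, (injective_iff_map_eq_zero Φ).mpr ?_, hΦ⟩
  rintro ⟨φ, s, hs⟩ hφ
  have hrs : r s = 0 := by
    by_contra hne
    obtain ⟨χ, hχ⟩ := exists_algHom_apply_ne_zero (k := ℂ) hne
    rw [hr, ← hs] at hχ
    exact hχ ((hΦ χ ⟨φ, s, hs⟩).symm.trans (by rw [hφ, map_zero]))
  have hfs : f.appTop s = 0 :=
    (Scheme.ΓSpecIso (.of A)).commRingCatIsoToRingEquiv.map_eq_zero_iff.mp hrs
  exact Subtype.ext (funext fun g => (hs g).trans (evalPoint_eq_zero_of_appTop_eq_zero f hfs g))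

end RegularFun

section RegularMap

variable {G : Over (Spec (.of ℂ))} {W : Type*} [AddCommGroup W] [Module ℂ W] {L : Points G → W}

/-- A map from the complex points of `G` to a vector space is regular (the restriction to complex
points of a morphism of schemes) when its composites with linear forms are regular functions. -/
def IsRegularMap (L : Points G → W) : Prop :=
  ∀ f : Module.Dual ℂ W, (fun g => f (L g)) ∈ regularFun G

theorem IsRegularMap.comp_mem (hL : IsRegularMap L) (p : polyFun W) : p.1 ∘ L ∈ regularFun G := by
  induction p using polyFun_induction with
  | ofDual f => exact hL f
  | algebraMap c => exact (regularFun G).algebraMap_mem c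
  | add p q hp hq => exact (regularFun G).add_mem hp hq
  | mul p q hp hq => exact (regularFun G).mul_mem hp hq

/-- Pullback of polynomial functions along a regular map. -/
def IsRegularMap.pullback (hL : IsRegularMap L) : polyFun W →ₐ[ℂ] regularFun G where
  toFun p := ⟨p.1 ∘ L, hL.comp_mem p⟩
  map_one' := rfl
  map_mul' _ _ := rfl
  map_zero' := rfl
  map_add' _ _ := rfl
  commutes' _ := rfl

theorem IsRegularMap.ker_pullback (hL : IsRegularMap L) :
    RingHom.ker hL.pullback = vanishingIdeal (Set.range L) := by
  ext p
  rw [mem_vanishingIdeal, Set.forall_mem_range, RingHom.mem_ker, Subtype.ext_iff, funext_iff]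
  rfl

theorem IsRegularMap.prodMk {W' : Type*} [AddCommGroup W'] [Module ℂ W'] {L' : Points G → W'}
    (hL : IsRegularMap L) (hL' : IsRegularMap L') : IsRegularMap fun g => (L g, L' g) := by
  intro f
  convert (regularFun G).add_mem (hL (f ∘ₗ LinearMap.inl ℂ W W'))
    (hL' (f ∘ₗ LinearMap.inr ℂ W W')) using 1
  ext g
  simp [← map_add]

section Irreducible

variable [LocallyOfFiniteType G.hom] [IrreducibleSpace G.left]

theorem IsRegularMap.isPrime_vanishingIdeal (hL : IsRegularMap L) :
    (vanishingIdeal (Set.range L)).IsPrime := by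
  obtain ⟨A, _, _, _, _, -, Φ, hΦ, -⟩ := exists_injective_regularFun_algHom G
  have : IsDomain (regularFun G) := hΦ.isDomain Φ.toRingHom
  rw [← hL.ker_pullback]
  exact RingHom.ker_isPrime _

theorem IsRegularMap.exists_mem_range [FiniteDimensional ℂ W] (hL : IsRegularMap L) :
    ∃ p ∉ vanishingIdeal (Set.range L),
      ∀ w ∈ zariskiClosure (Set.range L), p.1 w ≠ 0 → w ∈ Set.range L := by
  obtain ⟨A, _, _, _, _, pt, Φ, hΦ, hpt⟩ := exists_injective_regularFun_algHom G
  have hker : RingHom.ker (Φ.comp hL.pullback) = vanishingIdeal (Set.range L) := by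
    rw [← hL.ker_pullback]
    ext p
    exact map_eq_zero_iff Φ hΦ
  obtain ⟨p, hp, H⟩ := exists_notMem_ker_forall_exists_comp_eq (Φ.comp hL.pullback)
  refine ⟨p, hker ▸ hp, fun w hw hpw => ?_⟩
  obtain ⟨χ, hχ⟩ := H (polyFun.eval w) (hker ▸ mem_zariskiClosure.mp hw) hpw
  refine ⟨pt χ, ?_⟩
  rw [← sub_eq_zero, ← Module.forall_dual_apply_eq_zero_iff ℂ]
  intro f
  rw [map_sub, sub_eq_zero]
  calc f (L (pt χ)) = χ (Φ (hL.pullback (polyFun.ofDual f))) :=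
        (hpt χ (hL.pullback (polyFun.ofDual f))).symm
    _ = f w := DFunLike.congr_fun hχ (polyFun.ofDual f)

theorem IsRegularMap.range_inter_range_nonempty [FiniteDimensional ℂ W] {M : Set W}
    (hL : IsRegularMap L) (h : vanishingIdeal M = vanishingIdeal (Set.range L)) :
    (M ∩ Set.range L).Nonempty := by
  obtain ⟨p, hp, hrange⟩ := hL.exists_mem_range
  rw [← h, mem_vanishingIdeal] at hp
  push Not at hp
  obtain ⟨x, hx, hpx⟩ := hp
  refine ⟨x, hx, hrange x ?_ hpx⟩
  rw [← zariskiClosure_eq_iff.mpr h]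
  exact subset_zariskiClosure _ hx

end Irreducible

end RegularMap

section Rational

variable {G : Over (Spec (.of ℂ))} [GrpObj G] {V : Type*} [AddCommGroup V] [Module ℂ V]
  {ρ : Representation ℂ (Points G) V}

theorem IsRational.isRegularMap_orbit (hρ : IsRational G ρ) (v : V) :
    IsRegularMap fun g => ρ g v :=
  hρ v

theorem IsRational.isPrime_vanishingIdeal_of_mem [LocallyOfFiniteType G.hom]
    [IrreducibleSpace G.left] (hρ : IsRational G ρ) {O : Set V} (hO : O ∈ orbits ρ) :
    (vanishingIdeal O).IsPrime := by
  obtain ⟨v, rfl⟩ := hO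
  exact (hρ.isRegularMap_orbit v).isPrime_vanishingIdeal

theorem IsRational.injOn_vanishingIdeal_orbits [LocallyOfFiniteType G.hom]
    [IrreducibleSpace G.left] [FiniteDimensional ℂ V] (hρ : IsRational G ρ) :
    Set.InjOn vanishingIdeal (orbits ρ) := by
  rintro _ ⟨v, rfl⟩ _ ⟨w, rfl⟩ h
  obtain ⟨z, hv, hw⟩ := (hρ.isRegularMap_orbit w).range_inter_range_nonempty h
  exact (orbit_eq_of_mem (R := Module.End ℂ V) (τ := ρ) hv).symm.trans (orbit_eq_of_mem hw)

theorem IsRational.dual [FiniteDimensional ℂ V] (hρ : IsRational G ρ) : IsRational G ρ.dual := by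
  intro φ f
  obtain ⟨v, rfl⟩ := (Module.evalEquiv ℂ V).surjective f
  obtain ⟨s, hs⟩ := hρ v φ
  refine ⟨ι[G].left.appTop s, fun g => ?_⟩
  have hg : g⁻¹.left = g.left ≫ ι[G].left := rfl
  calc φ (ρ g⁻¹ v) = evalPoint g⁻¹ s := hs g⁻¹
    _ = evalPoint g (ι[G].left.appTop s) := by
      simp only [evalPoint, hg, Scheme.Hom.comp_appTop]
      rfl

theorem IsRational.isRegularMap [FiniteDimensional ℂ V] (hρ : IsRational G ρ) :
    IsRegularMap fun g => ρ g := by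
  intro f
  let b := Module.finBasis ℂ V
  have hf : (fun g => f (ρ g)) = ∑ ij, f (b.end ij) • fun g => b.coord ij.1 (ρ g (b ij.2)) := by
    ext g
    conv_lhs => rw [← b.end.sum_repr (ρ g)]
    simp only [map_sum, map_smul, Finset.sum_apply, Pi.smul_apply, smul_eq_mul]
    refine Finset.sum_congr rfl fun ij _ => ?_
    rw [mul_comm, Module.Basis.end_repr_apply]
    change _ * LinearMap.toMatrix b b (ρ g) ij.1 ij.2 = _
    rw [LinearMap.toMatrix_apply]
    rfl
  rw [hf]
  exact Subalgebra.sum_mem _ fun ij _ => Subalgebra.smul_mem _ (hρ _ _) _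

end Rational

/-! ### Cones and projective closures -/

section Cone

variable {V : Type*} [AddCommGroup V] [Module ℂ V] {C C' : Set V}

/-- Stability under multiplication by nonzero scalars. -/
def IsConical (C : Set V) : Prop :=
  ∀ c : ℂ, c ≠ 0 → ∀ x ∈ C, c • x ∈ C

theorem IsConical.smul_mem_iff (hC : IsConical C) {c : ℂ} (hc : c ≠ 0) {x : V} :
    c • x ∈ C ↔ x ∈ C :=
  ⟨fun h => by simpa [smul_smul, inv_mul_cancel₀ hc] using hC c⁻¹ (inv_ne_zero hc) _ h, hC c hc x⟩

protected theorem IsConical.zariskiClosure (hC : IsConical C) : IsConical (zariskiClosure C) :=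
  fun c hc _ hx _ hp hpC =>
    hx _ (polyFun_comp_linear hp (LinearMap.lsmul ℂ V c)) fun y hy => hpC _ (hC c hc y hy)

theorem exists_polynomial_eval_map_eq (p : polyFun V) : ∃ P : Polynomial (polyFun V),
    ∀ (c : ℂ) (v : V), (P.map (polyFun.eval v : _ →+* ℂ)).eval c = p.1 (c • v) := by
  induction p using polyFun_induction with
  | ofDual f => exact ⟨.monomial 1 (polyFun.ofDual f), fun c v => by
      simp [polyFun.ofDual, polyFun.eval, mul_comm]⟩
  | algebraMap a => exact ⟨.C (algebraMap ℂ _ a), fun c v => by simp⟩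
  | add p q hp hq =>
    obtain ⟨P, hP⟩ := hp
    obtain ⟨Q, hQ⟩ := hq
    exact ⟨P + Q, fun c v => by simp [Polynomial.map_add, hP, hQ]⟩
  | mul p q hp hq =>
    obtain ⟨P, hP⟩ := hp
    obtain ⟨Q, hQ⟩ := hq
    exact ⟨P * Q, fun c v => by simp [Polynomial.map_mul, hP, hQ]⟩

theorem coeff_smul_eq_pow_mul {p : polyFun V} {P : Polynomial (polyFun V)}
    (hP : ∀ (c : ℂ) (v : V), (P.map (polyFun.eval v : _ →+* ℂ)).eval c = p.1 (c • v)) (d : ℕ)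
    (c : ℂ) (v : V) : (P.coeff d).1 (c • v) = c ^ d * (P.coeff d).1 v := by
  have hcomp : P.map (polyFun.eval (c • v) : _ →+* ℂ) =
      (P.map (polyFun.eval v : _ →+* ℂ)).comp (.C c * .X) :=
    Polynomial.funext fun t => by simp [hP, smul_smul, mul_comm t]
  have := congr_arg (Polynomial.coeff · d) hcomp
  simp only [Polynomial.comp_C_mul_X_coeff, Polynomial.coeff_map] at this
  exact this.trans (mul_comm _ _)

theorem IsConical.mem_zariskiClosure_of_homogeneous (hC : IsConical C) {v : V}
    (h : ∀ p ∈ vanishingIdeal C,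
      (∃ d : ℕ, ∀ (c : ℂ) (x : V), p.1 (c • x) = c ^ d * p.1 x) → p.1 v = 0) :
    v ∈ zariskiClosure C := by
  refine mem_zariskiClosure.mpr fun p hp => ?_
  obtain ⟨P, hP⟩ := exists_polynomial_eval_map_eq p
  have hmap {x : V} (hx : x ∈ C) : P.map (polyFun.eval x : _ →+* ℂ) = 0 := by
    refine Polynomial.eq_zero_of_infinite_isRoot _
      ((Set.finite_singleton (0 : ℂ)).infinite_compl.mono fun c hc => ?_)
    exact (hP c x).trans (mem_vanishingIdeal.mp hp _ (hC c hc x hx))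
  have hcoeff (d : ℕ) : (P.coeff d).1 v = 0 := by
    refine h _ (mem_vanishingIdeal.mpr fun x hx => ?_) ⟨d, coeff_smul_eq_pow_mul hP d⟩
    have := congr_arg (Polynomial.coeff · d) (hmap hx)
    rwa [Polynomial.coeff_map] at this
  have hv : P.map (polyFun.eval v : _ →+* ℂ) = 0 :=
    Polynomial.ext fun d => (Polynomial.coeff_map _ _).trans (hcoeff d)
  rw [← one_smul ℂ v, ← hP, hv, Polynomial.eval_zero]

theorem IsConical.zero_mem_zariskiClosure (hC : IsConical C) (hne : C.Nonempty) :
    (0 : V) ∈ zariskiClosure C := by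
  obtain ⟨x, hx⟩ := hne
  refine hC.mem_zariskiClosure_of_homogeneous fun p hp ⟨d, hd⟩ => ?_
  have h0 := hd 0 x
  rwa [mem_vanishingIdeal.mp hp x hx, mul_zero, zero_smul] at h0

theorem IsConical.mk_mem_projectivize (hC : IsConical C) {v : V} (hv : v ≠ 0) :
    Projectivization.mk ℂ v hv ∈ projectivize C ↔ v ∈ C := by
  refine ⟨?_, fun h => ⟨v, hv, h, rfl⟩⟩
  rintro ⟨w, hw, hwC, h⟩
  obtain ⟨a, rfl⟩ := (Projectivization.mk_eq_mk_iff ℂ _ _ hw hv).mp h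
  exact (hC.smul_mem_iff a.ne_zero).mp hwC

theorem IsConical.cone_projectivize (hC : IsConical C) (h0 : (0 : V) ∈ C) :
    cone (projectivize C) = C := by
  ext v
  by_cases hv : v = 0
  · exact ⟨fun _ => hv ▸ h0, fun _ h => absurd hv h⟩
  · exact ⟨fun h => (hC.mk_mem_projectivize hv).mp (h hv),
      fun h _ => (hC.mk_mem_projectivize hv).mpr h⟩

theorem IsConical.projectivize_eq_iff (hC : IsConical C) (h0 : (0 : V) ∈ C) (hC' : IsConical C')
    (h0' : (0 : V) ∈ C') : projectivize C = projectivize C' ↔ C = C' :=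
  ⟨fun h => by rw [← hC.cone_projectivize h0, h, hC'.cone_projectivize h0'], congr_arg _⟩

theorem IsConical.rep_mem_iff (hC : IsConical C) (x : ℙ ℂ V) : x.rep ∈ C ↔ x ∈ projectivize C := by
  rw [← hC.mk_mem_projectivize x.rep_nonzero, x.mk_rep]

theorem IsConical.projClosure_projectivize (hC : IsConical C) :
    projClosure (projectivize C) = projectivize (zariskiClosure C) := by
  ext x
  rw [← hC.zariskiClosure.rep_mem_iff]
  refine ⟨fun hx => hC.mem_zariskiClosure_of_homogeneous fun p hp hd => ?_, ?_⟩
  · exact hx p p.2 hd fun y hy => mem_vanishingIdeal.mp hp _ ((hC.rep_mem_iff y).mpr hy)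
  · rintro hx p hp ⟨d, hd⟩ hpC
    have hpv {v : V} (hv : v ∈ C) (hv0 : v ≠ 0) : p v = 0 := by
      obtain ⟨a, ha⟩ := Projectivization.exists_smul_eq_mk_rep ℂ v hv0
      have := hpC _ ((hC.mk_mem_projectivize hv0).mpr hv)
      rw [← ha, Units.smul_def, hd] at this
      exact (mul_eq_zero.mp this).resolve_left (pow_ne_zero _ a.ne_zero)
    obtain ⟨y, hy, hy0⟩ : ∃ y ∈ C, y ≠ 0 := by
      by_contra! H
      refine x.rep_nonzero ((Module.forall_dual_apply_eq_zero_iff ℂ _).mp fun f => ?_)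
      exact hx f (polyFun.ofDual f).2 fun y hy => by rw [H y hy, map_zero]
    refine hx p hp fun v hv => ?_
    obtain rfl | hv0 := eq_or_ne v 0
    · rw [← zero_smul ℂ y, hd, hpv hy hy0, mul_zero]
    · exact hpv hv hv0

theorem units_smul_eq_self_of_finite {k X : Type*} [Field k] [IsAlgClosed k] [MulAction kˣ X]
    [Finite X] (a : kˣ) (x : X) : a • x = x := by
  have hn : Nat.card (Equiv.Perm X) ≠ 0 := Nat.card_pos.ne'
  obtain ⟨z, hz⟩ := IsAlgClosed.exists_pow_nat_eq (a : k) (Nat.pos_of_ne_zero hn)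
  have hz0 : z ≠ 0 := by
    rintro rfl
    exact a.ne_zero (hz.symm.trans (zero_pow hn))
  obtain rfl : Units.mk0 z hz0 ^ Nat.card (Equiv.Perm X) = a := Units.ext hz
  have := pow_card_eq_one' (x := MulAction.toPermHom kˣ X (Units.mk0 z hz0))
  rw [← map_pow] at this
  exact congr($this x)

open scoped Pointwise in
theorem isConical_of_finite_orbits {Γ : Type*} [Group Γ] {ρ : Representation ℂ Γ V}
    (hfin : (orbits ρ).Finite) {O : Set V} (hO : O ∈ orbits ρ) : IsConical O := by
  let S : SubMulAction ℂˣ (Set V) :=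
    { carrier := orbits ρ
      smul_mem' := by
        rintro a _ ⟨v, rfl⟩
        refine ⟨a • v, ?_⟩
        simp only [Units.smul_def, map_smul, Set.smul_set_range] }
  have : Finite S := hfin
  intro c hc x hx
  have h : Units.mk0 c hc • O = O :=
    congr_arg Subtype.val (units_smul_eq_self_of_finite (Units.mk0 c hc) (⟨O, hO⟩ : S))
  rw [← h]
  exact Set.smul_mem_smul_set (a := Units.mk0 c hc) hx

end Cone

/-! ### Dual varieties of irreducible cones -/

section DualVariety

variable {V : Type*} [AddCommGroup V] [Module ℂ V]

theorem tangentSpace_subset_zero {Y : Set V} (hY : Y ⊆ {0}) (v : V) : tangentSpace Y v ⊆ {0} := by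
  refine fun w hw => (Module.forall_dual_apply_eq_zero_iff ℂ w).mp fun f => ?_
  rw [← lineDeriv_ofDual f v w]
  refine mem_tangentSpace.mp hw _ (mem_vanishingIdeal.mpr fun y hy => ?_)
  rw [Set.mem_singleton_iff.mp (hY hy)]
  exact map_zero f

/-- The linear forms that are conormal to `Y` at a point of `D`. -/
def conormalForms (Y D : Set V) : Set (Module.Dual ℂ V) :=
  {ξ | ∃ v ∈ D, ξ ∈ annihilator (Module.Dual.eval ℂ V) (tangentSpace Y v)}

theorem isConical_conormalForms (Y D : Set V) : IsConical (conormalForms Y D) :=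
  fun c _ _ ⟨v, hv, hξ⟩ => ⟨v, hv, Submodule.smul_mem _ c hξ⟩

theorem conormalForms_congr {Y Z : Set V} (h : vanishingIdeal Y = vanishingIdeal Z) (D : Set V) :
    conormalForms Y D = conormalForms Z D := by
  simp only [conormalForms, tangentSpace_congr h]

theorem image_snd_conormal (O : Set V) :
    Prod.snd '' conormal (Module.Dual.eval ℂ V) O = conormalForms O O := by
  ext ξ
  exact ⟨fun ⟨z, hz, h⟩ => ⟨z.1, hz.1, h ▸ hz.2⟩, fun ⟨v, hv, hξ⟩ => ⟨(v, ξ), ⟨hv, hξ⟩, rfl⟩⟩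

theorem setOf_isTangentHyperplane (X : Set (ℙ ℂ V)) :
    {H | IsTangentHyperplane X H} =
      projectivize (conormalForms (cone X) {v | v ≠ 0 ∧ IsSmoothPoint (cone X) v}) := by
  ext H
  rw [← (isConical_conormalForms _ _).rep_mem_iff]
  refine exists_congr fun v => and_assoc.symm.trans (and_congr_right fun _ => ?_)
  simp only [Projectivization.submodule_eq, Submodule.mem_span_singleton, mem_annihilator]
  refine ⟨fun h => h _ ⟨1, one_smul _ _⟩, ?_⟩
  rintro h _ ⟨a, rfl⟩ w hw
  exact mul_eq_zero_of_right a (h w hw)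

variable [FiniteDimensional ℂ V]

theorem exists_differential_eq {Y : Set V} {v : V} {ξ : Module.Dual ℂ V}
    (hξ : ξ ∈ annihilator (Module.Dual.eval ℂ V) (tangentSpace Y v)) :
    ∃ q ∈ vanishingIdeal Y, differential q v = ξ := by
  let d : polyFun V →ₗ[ℂ] Module.Dual ℂ V :=
    { toFun := fun q => differential q v
      map_add' := fun p q => LinearMap.ext fun w => lineDeriv_add p q v w
      map_smul' := fun c q => LinearMap.ext fun w => by
        refine (congrArg (fun p : polyFun V => lineDeriv ℂ p.1 v w) (Algebra.smul_def c q)).trans ?_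
        rw [lineDeriv_mul, lineDeriv_algebraMap, mul_zero, add_zero]
        rfl }
  let S : Submodule ℂ (Module.Dual ℂ V) := ((vanishingIdeal Y).restrictScalars ℂ).map d
  have : FiniteDimensional ℂ S := FiniteDimensional.finiteDimensional_submodule S
  change ξ ∈ S
  rw [← Subspace.dualCoannihilator_dualAnnihilator_eq (W := S), Submodule.mem_dualAnnihilator]
  refine fun w hw => mem_annihilator.mp hξ w (mem_tangentSpace.mpr fun p hp => ?_)
  exact (Submodule.mem_dualCoannihilator _).mp hw _ ⟨p, hp, rfl⟩

theorem exists_polyFun_eq_comp_differential (p : polyFun (Module.Dual ℂ V)) (q : polyFun V) :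
    ∃ r : polyFun V, ∀ v, r.1 v = p.1 (differential q v) := by
  induction p using polyFun_induction with
  | ofDual f =>
    obtain ⟨w, rfl⟩ := (Module.evalEquiv ℂ V).surjective f
    exact exists_polyFun_eq_lineDeriv q w
  | algebraMap c => exact ⟨algebraMap ℂ _ c, fun v => rfl⟩
  | add p p' hp hp' =>
    obtain ⟨r, hr⟩ := hp
    obtain ⟨r', hr'⟩ := hp'
    exact ⟨r + r', fun v => congr_arg₂ (· + ·) (hr v) (hr' v)⟩
  | mul p p' hp hp' =>
    obtain ⟨r, hr⟩ := hp
    obtain ⟨r', hr'⟩ := hp'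
    exact ⟨r * r', fun v => congr_arg₂ (· * ·) (hr v) (hr' v)⟩

theorem vanishingIdeal_conormalForms_congr (Y : Set V) {D D' : Set V}
    (h : vanishingIdeal D = vanishingIdeal D') :
    vanishingIdeal (conormalForms Y D) = vanishingIdeal (conormalForms Y D') := by
  have le {D D' : Set V} (h : vanishingIdeal D = vanishingIdeal D') :
      vanishingIdeal (conormalForms Y D) ≤ vanishingIdeal (conormalForms Y D') := by
    refine fun p hp => mem_vanishingIdeal.mpr ?_
    rintro ξ ⟨v, hv, hξ⟩
    obtain ⟨q, hq, rfl⟩ := exists_differential_eq hξ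
    obtain ⟨r, hr⟩ := exists_polyFun_eq_comp_differential p q
    have hrD : r ∈ vanishingIdeal D := mem_vanishingIdeal.mpr fun x hx => by
      rw [hr]
      exact mem_vanishingIdeal.mp hp _
        ⟨x, hx, mem_annihilator.mpr fun w hw => mem_tangentSpace.mp hw q hq⟩
    rw [← hr]
    exact mem_vanishingIdeal.mp (h ▸ hrD) v hv
  exact (le h).antisymm (le h.symm)

theorem vanishingIdeal_ne_zero_and_isSmoothPoint {Y : Set V} [(vanishingIdeal Y).IsPrime]
    (hY : ∃ y ∈ Y, y ≠ 0) :
    vanishingIdeal {v | v ≠ 0 ∧ IsSmoothPoint Y v} = vanishingIdeal Y := by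
  obtain ⟨y, hy, hy0⟩ := hY
  obtain ⟨l, hl⟩ : ∃ l : Module.Dual ℂ V, l y ≠ 0 := by
    by_contra! h
    exact hy0 ((Module.forall_dual_apply_eq_zero_iff ℂ y).mp h)
  obtain ⟨f, hf, hfs⟩ := exists_notMem_forall_isSmoothPoint Y
  have hl' : polyFun.ofDual l ∉ vanishingIdeal Y := fun h => hl (mem_vanishingIdeal.mp h y hy)
  have hfl : f * polyFun.ofDual l ∉ vanishingIdeal Y := Ideal.IsPrime.mul_notMem ‹_› hf hl'
  refine le_antisymm ?_ (vanishingIdeal_anti fun v hv => hv.2.1)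
  rw [← vanishingIdeal_inter_ne_zero hfl]
  refine vanishingIdeal_anti fun v ⟨hv, hv0⟩ => ⟨?_, hfs v hv (left_ne_zero_of_mul hv0)⟩
  rintro rfl
  exact right_ne_zero_of_mul hv0 (map_zero l)

variable {O : Set V}

theorem IsConical.dualVariety_projectivize_zariskiClosure [hO : (vanishingIdeal O).IsPrime]
    (hC : IsConical O) (hne : (projectivize (zariskiClosure O)).Nonempty) :
    dualVariety (projectivize (zariskiClosure O)) =
      projectivize (zariskiClosure (conormalForms O O)) := by
  have hYO := vanishingIdeal_zariskiClosure O
  have hY : (vanishingIdeal (zariskiClosure O)).IsPrime := hYO ▸ hO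
  obtain ⟨_, y, hy0, hy, rfl⟩ := hne
  have h0 := hC.zero_mem_zariskiClosure (nonempty_of_isPrime_vanishingIdeal O)
  rw [dualVariety, setOf_isTangentHyperplane, hC.zariskiClosure.cone_projectivize h0,
    (isConical_conormalForms _ _).projClosure_projectivize, conormalForms_congr hYO,
    zariskiClosure_eq_iff.mpr (vanishingIdeal_conormalForms_congr O _)]
  exact (vanishingIdeal_ne_zero_and_isSmoothPoint ⟨y, hy, hy0⟩).trans hYO

theorem IsConical.isProjectivelyDual_iff [(vanishingIdeal O).IsPrime] (hC : IsConical O)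
    (X' : Set (ℙ ℂ (Module.Dual ℂ V))) :
    IsProjectivelyDual (projectivize (zariskiClosure O)) X' ↔
      projectivize (zariskiClosure (conormalForms O O)) = X' := by
  obtain h | h := (projectivize (zariskiClosure O)).eq_empty_or_nonempty
  · have hO : O ⊆ {0} := fun x hx => by_contra fun hx0 =>
      h.le ⟨x, hx0, subset_zariskiClosure O hx, rfl⟩
    obtain ⟨x, hx⟩ := nonempty_of_isPrime_vanishingIdeal O
    have huniv (ξ : Module.Dual ℂ V) : ξ ∈ conormalForms O O :=
      ⟨x, hx, mem_annihilator.mpr fun w hw => by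
        rw [tangentSpace_subset_zero hO x hw, map_zero, LinearMap.zero_apply]⟩
    have hP : projectivize (zariskiClosure (conormalForms O O)) = Set.univ :=
      Set.eq_univ_of_forall fun H =>
        ⟨H.rep, H.rep_nonzero, subset_zariskiClosure _ (huniv _), H.mk_rep⟩
    rw [hP, h, IsProjectivelyDual]
    simp [eq_comm]
  · rw [← hC.dualVariety_projectivize_zariskiClosure h, IsProjectivelyDual]
    simp [h, h.ne_empty]

end DualVariety

theorem IsRational.exists_equiv_isConormalDual {V : Type*} [AddCommGroup V] [Module ℂ V]
    [FiniteDimensional ℂ V] {G : Over (Spec (.of ℂ))} [GrpObj G] [LocallyOfFiniteType G.hom]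
    [IrreducibleSpace G.left] {ρ : Representation ℂ (Points G) V} (hρ : IsRational G ρ)
    (hfin : (orbits ρ).Finite) :
    (orbits ρ.dual).Finite ∧ ∃ e : orbits ρ ≃ orbits ρ.dual,
      ∀ O : orbits ρ, IsConormalDual (Module.Dual.eval ℂ V) (O : Set V) (e O : Set _) := by
  let R := Module.End ℂ V × Module.End ℂ (Module.Dual ℂ V)
  let : Module R V := Module.compHom V (RingHom.fst _ _)
  let : Module R (Module.Dual ℂ V) := Module.compHom _ (RingHom.snd _ _)
  have : IsScalarTower ℂ R V := ⟨fun c r x => LinearMap.smul_apply c r.1 x⟩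
  have : IsScalarTower ℂ R (Module.Dual ℂ V) := ⟨fun c r ξ => LinearMap.smul_apply c r.2 ξ⟩
  let τ : Points G →* R := MonoidHom.prod ρ ρ.dual
  have : (vanishingIdeal (Set.range τ)).IsPrime :=
    (hρ.isRegularMap.prodMk hρ.dual.isRegularMap).isPrime_vanishingIdeal
  exact exists_equiv_orbit_isConormalDual (τ := τ)
    (fun g x ξ => congr_arg ξ (ρ.inv_self_apply g x)) hfin
    hρ.injOn_vanishingIdeal_orbits hρ.dual.injOn_vanishingIdeal_orbits

end

end PyasetskiiDuality

open PyasetskiiDuality in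
theorem corollary2p9
    {V : Type*} [AddCommGroup V] [Module ℂ V] [FiniteDimensional ℂ V]
    (G : Over (Spec (.of ℂ))) [GrpObj G] [LocallyOfFiniteType G.hom] [QuasiCompact G.hom]
    [ConnectedSpace G.left]
    (ρ : Representation ℂ (Points G) V) (hρ : IsRational G ρ)
    (hfin : (orbits ρ).Finite) :
    (orbits ρ.dual).Finite ∧
    (orbits ρ.dual).ncard = (orbits ρ).ncard ∧
    ∃ e : orbits ρ ≃ orbits ρ.dual,
      ∀ (O : orbits ρ) (O' : orbits ρ.dual),
        e O = O' ↔
          IsProjectivelyDual (projectivize (zariskiClosure (O : Set V)))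
            (projectivize (zariskiClosure (O' : Set (Module.Dual ℂ V)))) := by
  have := irreducibleSpace_left G
  obtain ⟨hfin', e, he⟩ := hρ.exists_equiv_isConormalDual hfin
  refine ⟨hfin', (Set.ncard_congr' e).symm, e, fun O O' => ?_⟩
  have hprime : (vanishingIdeal (O : Set V)).IsPrime := hρ.isPrime_vanishingIdeal_of_mem O.2
  have hcone (O' : orbits ρ.dual) : IsConical (zariskiClosure (O' : Set (Module.Dual ℂ V))) :=
    (isConical_of_finite_orbits hfin' O'.2).zariskiClosure
  have hzero (O' : orbits ρ.dual) : 0 ∈ zariskiClosure (O' : Set (Module.Dual ℂ V)) :=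
    have := hρ.dual.isPrime_vanishingIdeal_of_mem O'.2
    (isConical_of_finite_orbits hfin' O'.2).zero_mem_zariskiClosure
      (nonempty_of_isPrime_vanishingIdeal _)
  have hclosure : zariskiClosure (conormalForms (O : Set V) O) = zariskiClosure (e O : Set _) := by
    rw [zariskiClosure_eq_iff, ← image_snd_conormal, (he O).vanishingIdeal_image_snd]
  rw [(isConical_of_finite_orbits hfin O.2).isProjectivelyDual_iff, hclosure,
    (hcone _).projectivize_eq_iff (hzero _) (hcone _) (hzero _), zariskiClosure_eq_iff,
    hρ.dual.injOn_vanishingIdeal_orbits.eq_iff (e O).2 O'.2, Subtype.ext_iff]
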